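/- **Setting.** There are $m$ boxes with independent values $v_i\sim F_i$ in $[0,\infty)$, where $F=(F_1,\dots,F_m)$ are known distributions of finite expectation. The boxes arrive in an order $\pi$ ($\pi(i)$ is the $i$-th box to arrive); on arrival the value of a box is revealed and must be accepted or rejected immediately and irrevocably, and at most one value is accepted. An *identity-blind* algorithm knows $F$ but not $\pi$, and at each step observes only the value of the arriving box, not which box it is; it is *randomized* if it is drawn, independently of the values and the order, from a probability distribution over deterministic identity-blind algorithms. Let $\mathrm{ALG}(F,\pi)$ be its expected accepted value ($0$ if nothing is accepted), and let $\mathrm{OPT}(F,\pi)$ be the supremum of the expected accepted values of online algorithms that know both $F$ and $\pi$. The *identity-blindness gap* of $\mathrm{ALG}$ is $$\Gamma(\mathrm{ALG})=\inf_{m,F,\pi}\frac{\mathrm{ALG}(F,\pi)}{\mathrm{OPT}(F,\pi)},$$ the infimum being over all instances with $\mathrm{OPT}(F,\pi)>0$. **Theorem.** 1. For every $\varepsilon>0$ there is no identity-blind algorithm, deterministic or randomized, with $\Gamma(\mathrm{ALG})\ge\frac12+\varepsilon$. 2. The following instance witnesses this. Let $n\ge 0$, $0<\varepsilon\le1$,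 and let $F^{n,\varepsilon}$ consist of $2n+2$ boxes: $n$ boxes with deterministic value $0$; $n$ boxes with value $1$ or $0$, each with probability $\frac12$; one free-reward box with value $1/\varepsilon$ with probability $\varepsilon$ and $0$ otherwise; one box with deterministic value $1$. For $x\in\{0,1\}^n$ with $|x|=\sum_i x_i$, let $\pi_x$ be an arrival order in which, for $1\le i\le n$, the $i$-th box is a Bernoulli box if $x_i=1$ and a zero box if $x_i=0$; these are followed by the remaining $n-|x|$ Bernoulli boxes, then the free-reward box, then the deterministic $1$, then the remaining $|x|$ zero boxes. (The matching among boxes of the same type is arbitrary; such orders exist.) Then $\mathrm{OPT}(F^{n,\varepsilon},\pi_x)\ge 2-\varepsilon$ for all $n$ and $x$. Moreover, for every $\varepsilon\in(0,1]$ and $\delta>0$ there is $N$ such that for all $n\ge N$, all choices of the orders $\pi_x$ and all identity-blind algorithms, deterministic or randomized, $$2^{-n}\sum_{x\in\{0,1\}^n}\mathrm{ALG}(F^{n,\varepsilon},\pi_x)\le 1+\delta.$$ 3. The bound is tight: there is a single-threshold algorithm (which, for a threshold $\tau(F)\ge 0$ depending only on $F$, accepts the first value that is at least $\tau(F)$;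 it is thus deterministic and identity-blind) whose identity-blindness gap is exactly $\frac12$. -/

import Mathlib

open MeasureTheory
open scoped NNReal ENNReal

universe u

namespace ProphetBlind

/-- A tuple of value distributions on `[0, ∞)`, one for each of the `n` boxes. -/
abbrev Dists (n : ℕ) : Type := Fin n → ProbabilityMeasure ℝ≥0

/-- A deterministic online stopping rule for a sequence of `n` nonnegative values. The set
`accept t` consists of the histories (the values seen at times `s ≤ t`) after which the value
arriving at time `t` is accepted, provided that nothing has been accepted before. -/
structure StoppingRule (n : ℕ) where
  accept : ∀ t : Fin n, Set (Set.Iic t → ℝ≥0)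
  measurableSet_accept : ∀ t, MeasurableSet (accept t)

namespace StoppingRule

variable {n : ℕ}

/-- On the value sequence `v`, the rule wants to accept at time `t`. -/
def Wants (R : StoppingRule n) (v : Fin n → ℝ≥0) (t : Fin n) : Prop :=
  (fun s : Set.Iic t => v s) ∈ R.accept t

/-- On the value sequence `v`, the rule accepts the value arriving at time `t`. -/
def StopsAt (R : StoppingRule n) (v : Fin n → ℝ≥0) (t : Fin n) : Prop :=
  R.Wants v t ∧ ∀ s < t, ¬ R.Wants v s

open Classical in
/-- The accepted value (`0` if no value is accepted; at most one summand is nonzero). -/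
noncomputable def reward (R : StoppingRule n) (v : Fin n → ℝ≥0) : ℝ≥0 :=
  ∑ t, if R.StopsAt v t then v t else 0

end StoppingRule

/-- The law of the arriving value sequence when box `π i` is the `i`-th to arrive: the product
`F (π 0) × F (π 1) × ...`. -/
noncomputable def arrivalLaw {n : ℕ} (F : Dists n) (π : Equiv.Perm (Fin n)) :
    Measure (Fin n → ℝ≥0) :=
  Measure.pi fun i => (F (π i) : Measure ℝ≥0)

/-- The expected accepted value of a stopping rule under the arrival order `π`. -/
noncomputable def expectedReward {n : ℕ} (R : StoppingRule n) (F : Dists n)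
    (π : Equiv.Perm (Fin n)) : ℝ≥0∞ :=
  ∫⁻ v, (R.reward v : ℝ≥0∞) ∂(arrivalLaw F π)

/-- The value of the optimal order-aware algorithm. The stopping rule may be chosen depending on
both `F` and `π`; as `π` is known, the values seen so far are all that is revealed online. -/
noncomputable def opt {n : ℕ} (F : Dists n) (π : Equiv.Perm (Fin n)) : ℝ≥0∞ :=
  ⨆ R : StoppingRule n, expectedReward R F π

/-- The worst-case ratio, over all numbers of boxes, all distributions with finite expectation and
all arrival orders, between a performance `perf` and the optimal order-aware performance. Instances
on which even the optimum is `0` (where the ratio would be `0 / 0`) are left out. -/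
noncomputable def worstRatio
    (perf : ∀ n : ℕ, Dists n → Equiv.Perm (Fin n) → ℝ≥0∞) : ℝ≥0∞ :=
  ⨅ (n : ℕ) (F : Dists n) (_ : ∀ i, ∫⁻ x, (x : ℝ≥0∞) ∂(F i : Measure ℝ≥0) ≠ ∞)
    (π : Equiv.Perm (Fin n)) (_ : opt F π ≠ 0), perf n F π / opt F π

/-- A deterministic identity-blind algorithm: it knows the distributions `F` from the outset, but
not the arrival order, and it bases its decisions only on the values seen so far. -/
def BlindAlgorithm : Type :=
  ∀ n : ℕ, Dists n → StoppingRule n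

namespace BlindAlgorithm

/-- The expected accepted value. -/
noncomputable def value (A : BlindAlgorithm) {n : ℕ} (F : Dists n) (π : Equiv.Perm (Fin n)) :
    ℝ≥0∞ :=
  expectedReward (A n F) F π

/-- The identity-blindness gap. -/
noncomputable def gap (A : BlindAlgorithm) : ℝ≥0∞ :=
  worstRatio fun _ F π => A.value F π

/-- The single-threshold algorithm: accept the first value that is at least `τ n F`. -/
def singleThreshold (τ : ∀ n : ℕ, Dists n → ℝ≥0) : BlindAlgorithm := fun n F =>
  { accept := fun t => {h | τ n F ≤ h ⟨t, le_refl t⟩}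
    measurableSet_accept := fun _ => measurableSet_le measurable_const (measurable_pi_apply _) }

end BlindAlgorithm

/-- A randomized identity-blind algorithm with random seed in `Ω`: a (jointly measurable) family of
deterministic identity-blind algorithms, from which one is drawn independently of the values and
of the arrival order. -/
structure RandomizedBlindAlgorithm (Ω : Type u) [MeasurableSpace Ω] where
  alg : Ω → BlindAlgorithm
  measurableSet_accept : ∀ (n : ℕ) (F : Dists n) (t : Fin n),
    MeasurableSet {p : Ω × (Set.Iic t → ℝ≥0) | p.2 ∈ (alg p.1 n F).accept t}

namespace RandomizedBlindAlgorithm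

variable {Ω : Type u} [MeasurableSpace Ω]

/-- The expected accepted value when the seed has law `P`. -/
noncomputable def value (A : RandomizedBlindAlgorithm Ω) (P : Measure Ω) {n : ℕ} (F : Dists n)
    (π : Equiv.Perm (Fin n)) : ℝ≥0∞ :=
  ∫⁻ ω, (A.alg ω).value F π ∂P

/-- The identity-blindness gap when the seed has law `P`. -/
noncomputable def gap (A : RandomizedBlindAlgorithm Ω) (P : Measure Ω) : ℝ≥0∞ :=
  worstRatio fun _ F π => A.value P F π

end RandomizedBlindAlgorithm

/-- The distribution with mass `p` at `x` and mass `1 - p` at `0`. -/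
noncomputable def twoPoint (p : ℝ≥0) (hp : p ≤ 1) (x : ℝ≥0) : ProbabilityMeasure ℝ≥0 :=
  ⟨p • Measure.dirac x + (1 - p) • Measure.dirac 0, ⟨by
    simp only [Measure.add_apply, Measure.smul_apply, measure_univ, ENNReal.smul_def, smul_eq_mul,
      mul_one]
    rw [← ENNReal.coe_add, add_tsub_cancel_of_le hp, ENNReal.coe_one]⟩⟩

/-- The four types of boxes: deterministic `0`, Bernoulli with parameter `1/2`, free reward,
deterministic `1`. -/
inductive BoxType
  | zero
  | coin
  | freeReward
  | one

/-- The distribution of a box of the given type, where the free reward is worth `1 / ε` with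
probability `ε` and `0` otherwise. -/
noncomputable def BoxType.law (ε : ℝ≥0) (hε : ε ≤ 1) : BoxType → ProbabilityMeasure ℝ≥0
  | .zero => twoPoint 1 le_rfl 0
  | .coin => twoPoint 2⁻¹ (inv_le_one_of_one_le₀ one_le_two) 1
  | .freeReward => twoPoint ε hε (1 / ε)
  | .one => twoPoint 1 le_rfl 1

/-- The types of the `2n + 2` boxes: `n` zero boxes, then `n` Bernoulli boxes, the free-reward box
and the deterministic `1`. -/
def boxType (n : ℕ) (i : Fin (2 * n + 2)) : BoxType :=
  if (i : ℕ) < n then .zero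
  else if (i : ℕ) < 2 * n then .coin
  else if (i : ℕ) = 2 * n then .freeReward
  else .one

/-- The hard instance. -/
noncomputable def hardDists (n : ℕ) (ε : ℝ≥0) (hε : ε ≤ 1) : Dists (2 * n + 2) :=
  fun i => (boxType n i).law ε hε

/-- The number of ones of a bit vector. -/
def weight {n : ℕ} (x : Fin n → Bool) : ℕ := (Finset.univ.filter fun i => x i = true).card

/-- The type of the box arriving at time `i` (counted from `0`) in an order driven by `x`: first
`n` boxes that are Bernoulli or zero according to the bits of `x`, then the remaining
`n - |x|` Bernoulli boxes, the free-reward box, the deterministic `1`, and the remaining `|x|` zero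
boxes. -/
def arrivalType {n : ℕ} (x : Fin n → Bool) (i : Fin (2 * n + 2)) : BoxType :=
  if h : (i : ℕ) < n then (if x ⟨i, h⟩ = true then .coin else .zero)
  else if (i : ℕ) < 2 * n - weight x then .coin
  else if (i : ℕ) = 2 * n - weight x then .freeReward
  else if (i : ℕ) = 2 * n - weight x + 1 then .one
  else .zero

/-- `π` is an arrival order driven by `x` (the matching among boxes of equal type is free). -/
def IsHardOrder {n : ℕ} (x : Fin n → Bool) (π : Equiv.Perm (Fin (2 * n + 2))) : Prop :=
  ∀ i, boxType n (π i) = arrivalType x i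

end ProphetBlind

/-! Impossibility. Under `π_x` a blind rule earns at most 1 before the free reward, and the free
reward has mean 1. Earning more than 1 in expectation therefore requires accepting the deterministic
1 exactly when the free reward turned out 0. On that event the last two values read 0, 1, as two
fair coins might, so up to a factor 4 the rule is facing a run of coins and zeros of unknown length,
and must guess its end (`measure_stopsAt_oneTime_le`).

The end is at time `2n - |x| + 1`, so the rule must know `|x|`. Couple all `x` through one coin
sequence, deleting the early coins whose bit is 0. A coin that lands 0 looks the same deleted or
not, so about half of the bits stay invisible. A fixed observed sequence has only one stopping time,
hence is right for only one weight `|x|`. Among the completions of `m` invisible bits at most the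
fraction `choose m (m/2) / 2^m`, of order `m^(-1/2)`, has that weight (`card_mul_four_pow_le`). The
average reward over `x` is thus `1 + o(1)`, whereas an order-aware rule gets `2 - ε`.

Tightness is the prophet inequality with threshold half the expected maximum
(`singleThreshold_value_ge`). It guarantees half of the expected maximum, which dominates the
order-aware optimum; the impossibility result excludes anything better. -/

namespace ProphetBlind

/-! ### Product measures: resampling a coordinate, and domination -/

section ProductMeasure

theorem measurable_update_prod {ι X : Type*} [MeasurableSpace X] [DecidableEq ι] (t : ι) :
    Measurable fun p : (ι → X) × X => Function.update p.1 t p.2 := by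
  refine measurable_pi_lambda _ fun i => ?_
  by_cases h : i = t
  · subst h; simpa using measurable_snd
  · simp only [Function.update_of_ne h]
    exact (measurable_pi_apply i).comp measurable_fst

variable {ι : Type*} [Fintype ι] {X : Type*} [MeasurableSpace X]

theorem lintegral_pi_prod (μ : ι → Measure X) [∀ i, IsProbabilityMeasure (μ i)]
    (f : ι → X → ℝ≥0∞) (hf : ∀ i, Measurable (f i)) :
    ∫⁻ v, ∏ i, f i (v i) ∂(Measure.pi μ) = ∏ i, ∫⁻ x, f i x ∂(μ i) := by
  have h := ProbabilityTheory.lintegral_prod_eq_prod_lintegral_of_indepFun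
    (μ := Measure.pi μ) Finset.univ (fun i v => f i (v i))
    (ProbabilityTheory.iIndepFun_pi (fun i => (hf i).aemeasurable))
    (fun i => (hf i).comp (measurable_pi_apply i))
  rw [h]
  exact Finset.prod_congr rfl fun i _ =>
    (measurePreserving_eval μ i).lintegral_comp (hf i)

/-- Resampling one coordinate from its own law leaves the product unchanged. This is how
independence of one coordinate from the others is used below. -/
theorem map_update_pi [DecidableEq ι] (μ : ι → Measure X) [∀ i, IsProbabilityMeasure (μ i)]
    (t : ι) :
    ((Measure.pi μ).prod (μ t)).map (fun p => Function.update p.1 t p.2) = Measure.pi μ := by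
  symm
  have hm := measurable_update_prod (ι := ι) (X := X) t
  refine Measure.pi_eq fun s hs => ?_
  rw [Measure.map_apply hm (MeasurableSet.univ_pi hs)]
  have : (fun p : (ι → X) × X => Function.update p.1 t p.2) ⁻¹' Set.univ.pi s
      = (Set.univ.pi (Function.update s t Set.univ)) ×ˢ (s t) := by
    ext p
    simp only [Set.mem_preimage, Set.mem_pi, Set.mem_univ, true_imp_iff, Set.mem_prod]
    constructor
    · intro h
      refine ⟨fun i => ?_, by simpa using h t⟩
      by_cases hi : i = t
      · subst hi; simp
      · simpa [Function.update_of_ne hi] using h i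
    · rintro ⟨h, ht⟩ i
      by_cases hi : i = t
      · subst hi; simpa using ht
      · simpa [Function.update_of_ne hi] using h i
  rw [this, Measure.prod_prod, Measure.pi_pi, ← Finset.prod_erase_mul _ _ (Finset.mem_univ t),
    ← Finset.prod_erase_mul Finset.univ (fun i => μ i (s i)) (Finset.mem_univ t)]
  simp only [Function.update_self, measure_univ, mul_one]
  congr 1
  refine Finset.prod_congr rfl fun i hi => ?_
  rw [Function.update_of_ne (Finset.ne_of_mem_erase hi)]

/-- After resampling coordinate `t`, the factor `f` sees only the old point and `g` only the fresh
value, so the integral factors. -/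
theorem lintegral_pi_mul_eval [DecidableEq ι] (μ : ι → Measure X)
    [∀ i, IsProbabilityMeasure (μ i)] (t : ι) {f : (ι → X) → ℝ≥0∞} {g : X → ℝ≥0∞}
    (hf : Measurable f) (hg : Measurable g)
    (hft : ∀ v x, f (Function.update v t x) = f v) :
    ∫⁻ v, f v * g (v t) ∂(Measure.pi μ) = (∫⁻ v, f v ∂(Measure.pi μ)) * ∫⁻ x, g x ∂(μ t) := by
  have hm := measurable_update_prod (ι := ι) (X := X) t
  conv_lhs => rw [← map_update_pi μ t]
  have hfg : Measurable fun v : ι → X => f v * g (v t) :=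
    hf.mul (hg.comp (measurable_pi_apply t))
  rw [lintegral_map hfg hm]
  simp only [hft, Function.update_self]
  exact lintegral_prod_mul hf.aemeasurable hg.aemeasurable

theorem pi_le_prod_smul_pi (μ ν : ι → Measure X) [∀ i, SigmaFinite (μ i)]
    [∀ i, SigmaFinite (ν i)] (a : ι → ℝ≥0) (h : ∀ i, μ i ≤ a i • ν i) :
    Measure.pi μ ≤ (∏ i, a i) • Measure.pi ν := by
  have hν : Measure.pi (fun i => a i • ν i) = (∏ i, a i) • Measure.pi ν := by
    refine Measure.pi_eq fun s _ => ?_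
    rw [Measure.smul_apply, Measure.pi_pi, ENNReal.smul_def, ENNReal.ofNNReal_finsetProd, smul_eq_mul,
      ← Finset.prod_mul_distrib]
    rfl
  rw [← hν]
  refine Measure.le_iff.2 fun s hs => ?_
  -- The product outer measure is the largest one bounded by the product formula on rectangles, so
  -- it suffices to compare there.
  rw [Measure.pi, Measure.pi, toMeasure_apply _ _ hs, toMeasure_apply _ _ hs]
  refine OuterMeasure.le_pi.2 (fun s _ => ?_) s
  exact (OuterMeasure.pi_pi_le _ _).trans (Finset.prod_le_prod' fun i _ => h i _)

end ProductMeasure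

/-! ### Pathwise behaviour of stopping rules -/

namespace StoppingRule

variable {n : ℕ} (R : StoppingRule n)

theorem measurableSet_wants (t : Fin n) : MeasurableSet {v | R.Wants v t} :=
  (measurable_pi_lambda (fun v : Fin n → ℝ≥0 => fun s : Set.Iic t => v s)
    fun s => measurable_pi_apply (s : Fin n)) (R.measurableSet_accept t)

theorem measurableSet_stopsAt (t : Fin n) : MeasurableSet {v | R.StopsAt v t} := by
  simp only [StopsAt, Set.ofPred_and, Set.ofPred_forall]
  exact (R.measurableSet_wants t).inter
    (MeasurableSet.iInter fun s => MeasurableSet.iInter fun _ => (R.measurableSet_wants s).compl)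

variable {R}

theorem wants_congr {v w : Fin n → ℝ≥0} {t : Fin n} (h : ∀ s ≤ t, v s = w s) :
    R.Wants v t ↔ R.Wants w t := by
  have : (fun s : Set.Iic t => v s) = fun s : Set.Iic t => w s := funext fun s => h s s.2
  simp only [Wants, this]

theorem stopsAt_congr {v w : Fin n → ℝ≥0} {t : Fin n} (h : ∀ s ≤ t, v s = w s) :
    R.StopsAt v t ↔ R.StopsAt w t := by
  have h1 : ∀ s < t, (R.Wants v s ↔ R.Wants w s) := fun s hs =>
    wants_congr fun r hr => h r (hr.trans hs.le)
  simp only [StopsAt, wants_congr h]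
  exact and_congr_right fun _ => forall₂_congr fun s hs => not_congr (h1 s hs)

theorem StopsAt.eq {v : Fin n → ℝ≥0} {s t : Fin n} (hs : R.StopsAt v s) (ht : R.StopsAt v t) :
    s = t := by
  rcases lt_trichotomy s t with h | h | h
  · exact absurd hs.1 (ht.2 s h)
  · exact h
  · exact absurd ht.1 (hs.2 t h)

theorem exists_stopsAt_of_wants {v : Fin n → ℝ≥0} {t : Fin n} (h : R.Wants v t) :
    ∃ s ≤ t, R.StopsAt v s := by
  induction t using WellFoundedLT.induction with
  | ind t ih =>
    by_cases hs : ∃ s < t, R.Wants v s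
    · obtain ⟨s, hst, hw⟩ := hs
      obtain ⟨r, hr, hr'⟩ := ih s hst hw
      exact ⟨r, hr.trans hst.le, hr'⟩
    · push Not at hs
      exact ⟨t, le_rfl, h, hs⟩

theorem reward_of_stopsAt {v : Fin n → ℝ≥0} {t : Fin n} (h : R.StopsAt v t) :
    R.reward v = v t := by
  classical
  rw [reward, Finset.sum_eq_single t]
  · exact if_pos h
  · exact fun s _ hs => if_neg fun h' => hs (h'.eq h)
  · simp

theorem reward_of_not_stopsAt {v : Fin n → ℝ≥0} (h : ∀ t, ¬ R.StopsAt v t) :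
    R.reward v = 0 := by
  classical
  exact Finset.sum_eq_zero fun t _ => if_neg (h t)

theorem reward_le {v : Fin n → ℝ≥0} {b : ℝ≥0} (h : ∀ t, R.StopsAt v t → v t ≤ b) :
    R.reward v ≤ b := by
  by_cases hs : ∃ t, R.StopsAt v t
  · obtain ⟨t, ht⟩ := hs
    rw [reward_of_stopsAt ht]
    exact h t ht
  · push Not at hs
    rw [reward_of_not_stopsAt hs]
    exact zero_le

end StoppingRule

instance {n : ℕ} (F : Dists n) (π : Equiv.Perm (Fin n)) :
    IsProbabilityMeasure (arrivalLaw F π) := by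
  unfold arrivalLaw; infer_instance

theorem lintegral_twoPoint (p : ℝ≥0) (hp : p ≤ 1) (x : ℝ≥0) (f : ℝ≥0 → ℝ≥0∞) :
    ∫⁻ y, f y ∂(twoPoint p hp x : Measure ℝ≥0) = p * f x + (1 - p : ℝ≥0) * f 0 := by
  change ∫⁻ y, f y ∂(p • Measure.dirac x + (1 - p) • Measure.dirac 0) = _
  rw [lintegral_add_measure, lintegral_smul_measure, lintegral_smul_measure, lintegral_dirac,
    lintegral_dirac]
  rfl

/-! ### The prophet inequality for a single threshold -/

section Prophet

variable {n : ℕ}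

theorem measurable_sup_univ : Measurable fun v : Fin n → ℝ≥0 => Finset.univ.sup v := by
  simp only [Finset.sup_univ_eq_ciSup]
  exact Measurable.iSup fun i => measurable_pi_apply i

/-- The expected maximum of all values, i.e. the reward of a prophet. -/
noncomputable def expectedMax (F : Dists n) : ℝ≥0∞ :=
  ∫⁻ v, (Finset.univ.sup v : ℝ≥0) ∂(Measure.pi fun i => (F i : Measure ℝ≥0))

theorem lintegral_sup_arrivalLaw (F : Dists n) (π : Equiv.Perm (Fin n)) :
    ∫⁻ v, (Finset.univ.sup v : ℝ≥0) ∂(arrivalLaw F π) = expectedMax F := by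
  rw [expectedMax, ← (measurePreserving_piCongrLeft (fun i => (F i : Measure ℝ≥0)) π).lintegral_comp
    (measurable_sup_univ.coe_nnreal_ennreal)]
  refine lintegral_congr fun v => ?_
  congr 1
  have key : ∀ i, MeasurableEquiv.piCongrLeft (fun _ => ℝ≥0) π v (π i) = v i := fun i =>
    Equiv.piCongrLeft_apply_apply (fun _ => ℝ≥0) π v i
  refine le_antisymm (Finset.sup_le fun i _ => ?_) (Finset.sup_le fun i _ => ?_)
  · rw [← key i]; exact Finset.le_sup (Finset.mem_univ _)
  · rw [← π.apply_symm_apply i, key]; exact Finset.le_sup (Finset.mem_univ _)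

theorem expectedMax_ne_top (F : Dists n)
    (hF : ∀ i, ∫⁻ x, (x : ℝ≥0∞) ∂(F i : Measure ℝ≥0) ≠ ∞) : expectedMax F ≠ ∞ := by
  have hm : ∀ i : Fin n, Measurable fun v : Fin n → ℝ≥0 => (v i : ℝ≥0∞) := fun i =>
    (measurable_pi_apply i).coe_nnreal_ennreal
  have : expectedMax F ≤ ∑ i, ∫⁻ x, (x : ℝ≥0∞) ∂(F i : Measure ℝ≥0) := by
    calc expectedMax F ≤ ∫⁻ v, ∑ i, (v i : ℝ≥0∞) ∂(Measure.pi fun i => (F i : Measure ℝ≥0)) := by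
          refine lintegral_mono fun v => ?_
          rw [← ENNReal.ofNNReal_finsetSum]
          exact ENNReal.coe_le_coe.2 (Finset.sup_le fun i _ =>
            Finset.single_le_sum (fun _ _ => zero_le) (Finset.mem_univ i))
      _ = ∑ i, ∫⁻ v, (v i : ℝ≥0∞) ∂(Measure.pi fun i => (F i : Measure ℝ≥0)) :=
          lintegral_finsetSum _ fun i _ => hm i
      _ = _ := Finset.sum_congr rfl fun i _ =>
          (measurePreserving_eval (fun i => (F i : Measure ℝ≥0)) i).lintegral_comp
            measurable_coe_nnreal_ennreal
  exact ne_top_of_le_ne_top (ENNReal.sum_ne_top.2 fun i _ => hF i) this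

theorem opt_le_expectedMax (F : Dists n) (π : Equiv.Perm (Fin n)) : opt F π ≤ expectedMax F := by
  refine iSup_le fun R => ?_
  rw [← lintegral_sup_arrivalLaw F π]
  exact lintegral_mono fun v => ENNReal.coe_le_coe.2
    (StoppingRule.reward_le fun t _ => Finset.le_sup (Finset.mem_univ t))

/-- The reward is the threshold plus the surplus over it. In the sum, truncated subtraction kills
the terms before the accepted time and the indicator kills those after it. -/
theorem singleThreshold_reward_ge (τ : ∀ n : ℕ, Dists n → ℝ≥0) (F : Dists n) (v : Fin n → ℝ≥0) :
    {v : Fin n → ℝ≥0 | ∀ s, v s < τ n F}ᶜ.indicator (fun _ => (τ n F : ℝ≥0∞)) v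
      + ∑ t, {v : Fin n → ℝ≥0 | ∀ s < t, v s < τ n F}.indicator 1 v * ((v t : ℝ≥0∞) - τ n F)
      ≤ ((BlindAlgorithm.singleThreshold τ n F).reward v : ℝ≥0∞) := by
  set R := BlindAlgorithm.singleThreshold τ n F
  have hw : ∀ t, R.Wants v t ↔ τ n F ≤ v t := fun t => Iff.rfl
  by_cases h : ∃ t, R.StopsAt v t
  · obtain ⟨t, ht⟩ := h
    have hlt : ∀ s < t, v s < τ n F := fun s hs => not_le.1 (ht.2 s hs)
    have hle : τ n F ≤ v t := ht.1
    rw [StoppingRule.reward_of_stopsAt ht, Finset.sum_eq_single t]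
    · rw [Set.indicator_of_mem (show v ∈ {v : Fin n → ℝ≥0 | ∀ s < t, v s < τ n F} from hlt),
        Set.indicator_of_mem
          (show v ∈ {v : Fin n → ℝ≥0 | ∀ s, v s < τ n F}ᶜ from fun h : ∀ s, v s < τ n F => (h t).not_ge hle),
        Pi.one_apply, one_mul, add_tsub_cancel_of_le (ENNReal.coe_le_coe.2 hle)]
    · intro s _ hs
      rcases lt_or_gt_of_ne hs with h | h
      · rw [tsub_eq_zero_of_le (ENNReal.coe_le_coe.2 (hlt s h).le), mul_zero]
      · rw [Set.indicator_of_notMem, zero_mul]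
        exact fun h' => (h' t h).not_ge hle
    · simp
  · have hlt : ∀ s, v s < τ n F := fun s => not_le.1 fun hs =>
      h ((StoppingRule.exists_stopsAt_of_wants ((hw s).2 hs)).imp fun _ h => h.2)
    rw [Set.indicator_of_notMem (Set.notMem_compl_iff.2
      (show v ∈ {v : Fin n → ℝ≥0 | ∀ s, v s < τ n F} from hlt)), zero_add, Finset.sum_eq_zero]
    · exact zero_le
    · intro s _
      rw [tsub_eq_zero_of_le (ENNReal.coe_le_coe.2 (hlt s).le), mul_zero]

/-- If all values stay below the threshold `a`, the loss of `a` is compensated by the surpluses: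
each time `t` is reached with probability at least `μ N`, independently of `v t`, and the expected
surpluses sum to at least `a`. -/
theorem singleThreshold_value_ge (τ : ∀ n : ℕ, Dists n → ℝ≥0) (F : Dists n)
    (hτ : (τ n F : ℝ≥0∞) + τ n F = expectedMax F) (π : Equiv.Perm (Fin n)) :
    (τ n F : ℝ≥0∞) ≤ (BlindAlgorithm.singleThreshold τ).value F π := by
  set a := τ n F with ha
  set μ := arrivalLaw F π with hμ
  set N : Set (Fin n → ℝ≥0) := {v | ∀ s, v s < a}
  set A : Fin n → Set (Fin n → ℝ≥0) := fun t => {v | ∀ s < t, v s < a} with hA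
  have hAm : ∀ t, MeasurableSet (A t) := fun t => by
    simp only [hA, Set.ofPred_forall]
    exact MeasurableSet.iInter fun s => MeasurableSet.iInter fun _ =>
      measurableSet_lt (measurable_pi_apply s) measurable_const
  have hNm : MeasurableSet N := by
    simp only [N, Set.ofPred_forall]
    exact MeasurableSet.iInter fun s => measurableSet_lt (measurable_pi_apply s) measurable_const
  have hg : Measurable fun x : ℝ≥0 => (x : ℝ≥0∞) - a := measurable_coe_nnreal_ennreal.sub_const _
  have hgt : ∀ t : Fin n, Measurable fun v : Fin n → ℝ≥0 => (v t : ℝ≥0∞) - a := fun t =>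
    hg.comp (measurable_pi_apply t)
  -- The maximum is at most `a` plus the sum of all surpluses; its mean is `2a`, so one `a` cancels.
  have hτ' : (a : ℝ≥0∞) ≤ ∑ t, ∫⁻ x, ((x : ℝ≥0∞) - a) ∂(F (π t) : Measure ℝ≥0) := by
    have h1 : (a : ℝ≥0∞) + a ≤ a + ∑ t, ∫⁻ x, ((x : ℝ≥0∞) - a) ∂(F (π t) : Measure ℝ≥0) := by
      rw [hτ, ← lintegral_sup_arrivalLaw F π]
      calc ∫⁻ v, (Finset.univ.sup v : ℝ≥0) ∂μ
          ≤ ∫⁻ v, (a + ∑ t, ((v t : ℝ≥0∞) - a)) ∂μ := by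
            refine lintegral_mono fun v => ?_
            have : ∀ t, (v t : ℝ≥0∞) ≤ a + ∑ t, ((v t : ℝ≥0∞) - a) := fun t =>
              le_add_tsub.trans (add_le_add le_rfl (Finset.single_le_sum
                (f := fun t => (v t : ℝ≥0∞) - a) (fun _ _ => zero_le) (Finset.mem_univ t)))
            have hfin : (a + ∑ t, ((v t : ℝ≥0∞) - a)) ≠ ∞ :=
              ENNReal.add_ne_top.2 ⟨ENNReal.coe_ne_top, ENNReal.sum_ne_top.2 fun t _ =>
                ENNReal.sub_ne_top ENNReal.coe_ne_top⟩
            rw [← ENNReal.coe_toNNReal hfin]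
            exact ENNReal.coe_le_coe.2 (Finset.sup_le fun t _ => by
              rw [← ENNReal.coe_le_coe, ENNReal.coe_toNNReal hfin]; exact this t)
        _ = a + ∑ t, ∫⁻ v, ((v t : ℝ≥0∞) - a) ∂μ := by
            rw [lintegral_add_left measurable_const, lintegral_finsetSum _ fun t _ => hgt t]
            simp
        _ = _ := by
            congr 1
            exact Finset.sum_congr rfl fun t _ =>
              (measurePreserving_eval (fun i => (F (π i) : Measure ℝ≥0)) t).lintegral_comp hg
    exact (ENNReal.add_le_add_iff_left ENNReal.coe_ne_top).1 h1
  calc (a : ℝ≥0∞) = a * μ Nᶜ + μ N * a := by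
        rw [mul_comm (μ N), ← mul_add, add_comm, measure_add_measure_compl hNm, measure_univ,
          mul_one]
    _ ≤ a * μ Nᶜ + ∑ t, μ (A t) * ∫⁻ x, ((x : ℝ≥0∞) - a) ∂(F (π t) : Measure ℝ≥0) := by
        gcongr
        refine (mul_le_mul_right hτ' _).trans ?_
        rw [Finset.mul_sum]
        gcongr with t
        exact fun v hv s _ => hv s
    _ = ∫⁻ v, Nᶜ.indicator (fun _ => (a : ℝ≥0∞)) v
          + ∑ t, (A t).indicator 1 v * ((v t : ℝ≥0∞) - a) ∂μ := by
        rw [lintegral_add_left (measurable_const.indicator hNm.compl),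
          lintegral_indicator_const hNm.compl]
        have hAg : ∀ t, Measurable fun v : Fin n → ℝ≥0 =>
            (A t).indicator (1 : (Fin n → ℝ≥0) → ℝ≥0∞) v * ((v t : ℝ≥0∞) - a) := fun t =>
          (measurable_one.indicator (hAm t)).mul (hgt t)
        rw [lintegral_finsetSum _ fun t _ => hAg t]
        congr 1
        refine Finset.sum_congr rfl fun t _ => ?_
        -- `A t` looks only at times before `t`, so it is independent of the surplus at `t`.
        rw [hμ, arrivalLaw, lintegral_pi_mul_eval _ t (measurable_one.indicator (hAm t)) hg,
          lintegral_indicator_one (hAm t)]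
        intro v x
        have : Function.update v t x ∈ A t ↔ v ∈ A t := by
          refine forall₂_congr fun s hs => ?_
          rw [Function.update_of_ne hs.ne]
        by_cases hv : v ∈ A t
        · rw [Set.indicator_of_mem hv, Set.indicator_of_mem (this.2 hv)]; rfl
        · rw [Set.indicator_of_notMem hv, Set.indicator_of_notMem (mt this.1 hv)]
    _ ≤ _ := lintegral_mono fun v => singleThreshold_reward_ge τ F v

/-- Half of the expected maximum, as a threshold. -/
noncomputable def halfMax (n : ℕ) (F : Dists n) : ℝ≥0 := (expectedMax F).toNNReal / 2

theorem half_le_gap_singleThreshold_halfMax :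
    1 / 2 ≤ (BlindAlgorithm.singleThreshold halfMax).gap := by
  refine le_iInf fun n => le_iInf fun F => le_iInf fun hF => le_iInf fun π => le_iInf fun h0 => ?_
  have hfin := expectedMax_ne_top F hF
  have hτ : (halfMax n F : ℝ≥0∞) + halfMax n F = expectedMax F := by
    rw [← ENNReal.coe_add, halfMax, add_halves, ENNReal.coe_toNNReal hfin]
  have hopt := opt_le_expectedMax F π
  rw [ENNReal.le_div_iff_mul_le (.inl h0) (.inl (ne_top_of_le_ne_top hfin hopt))]
  refine le_trans ?_ (singleThreshold_value_ge halfMax F hτ π)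
  calc 1 / 2 * opt F π ≤ 1 / 2 * expectedMax F := by gcongr
    _ = halfMax n F := by
      rw [← hτ, ← two_mul, ← mul_assoc, one_div,
        ENNReal.inv_mul_cancel two_ne_zero ENNReal.ofNat_ne_top, one_mul]

end Prophet

/-! ### The hard orders and their order-aware optimum -/

section Orders

variable {n : ℕ}

theorem weight_le (x : Fin n → Bool) : weight x ≤ n :=
  (Finset.card_filter_le _ _).trans_eq (by simp)

/-- The arrival time of the free reward in an order driven by `x`. -/
def freeTime (x : Fin n → Bool) : Fin (2 * n + 2) := ⟨2 * n - weight x, by omega⟩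

/-- The arrival time of the deterministic `1` in an order driven by `x`. -/
def oneTime (x : Fin n → Bool) : Fin (2 * n + 2) := ⟨2 * n - weight x + 1, by omega⟩

theorem freeTime_lt_oneTime (x : Fin n → Bool) : freeTime x < oneTime x := by
  simp [freeTime, oneTime]

theorem weight_eq_of_oneTime_eq {x y : Fin n → Bool} (h : oneTime x = oneTime y) :
    weight x = weight y := by
  have := weight_le x
  have := weight_le y
  simp only [oneTime, Fin.mk.injEq] at h
  omega

theorem arrivalType_of_lt (x : Fin n → Bool) {i : Fin (2 * n + 2)} (h : (i : ℕ) < n) :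
    arrivalType x i = if x ⟨i, h⟩ = true then .coin else .zero := dif_pos h

theorem arrivalType_of_ge_of_lt (x : Fin n → Bool) {i : Fin (2 * n + 2)} (h : n ≤ (i : ℕ))
    (h' : i < freeTime x) : arrivalType x i = .coin := by
  have h'' : (i : ℕ) < 2 * n - weight x := h'
  simp [arrivalType, not_lt.2 h, h'']

theorem arrivalType_freeTime (x : Fin n → Bool) : arrivalType x (freeTime x) = .freeReward := by
  have := weight_le x
  have h : ¬ 2 * n - weight x < n := by omega
  simp [arrivalType, freeTime, h]

theorem arrivalType_oneTime (x : Fin n → Bool) : arrivalType x (oneTime x) = .one := by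
  have := weight_le x
  have h : ¬ 2 * n - weight x + 1 < n := by omega
  simp [arrivalType, oneTime, h]

theorem arrivalType_of_oneTime_lt (x : Fin n → Bool) {i : Fin (2 * n + 2)} (h : oneTime x < i) :
    arrivalType x i = .zero := by
  have := weight_le x
  have h' : 2 * n - weight x + 1 < (i : ℕ) := h
  have h1 : ¬ (i : ℕ) < n := by omega
  have h2 : ¬ (i : ℕ) < 2 * n - weight x := by omega
  have h3 : (i : ℕ) ≠ 2 * n - weight x := by omega
  have h4 : (i : ℕ) ≠ 2 * n - weight x + 1 := by omega
  simp [arrivalType, h1, h2, h3, h4]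

open Classical in
-- The tail supplies exactly the `n - |x|` coins and `|x|` zeros missing from the first `n`
-- arrivals. Equal counts per type are what makes a type-preserving permutation exist.
theorem card_fiber_arrivalType (x : Fin n → Bool) (T : BoxType) :
    (Finset.univ.filter fun i => arrivalType x i = T).card
      = (Finset.univ.filter fun i => boxType n i = T).card := by
  have hw := weight_le x
  have hx : (Finset.univ.filter fun i => x i = true).card = weight x := rfl
  have hx' : (Finset.univ.filter fun i => x i = false).card = n - weight x := by
    have h := Finset.card_filter_add_card_filter_not (s := Finset.univ) (fun i => x i = true)
    simp only [Bool.not_eq_true, Finset.card_univ, Fintype.card_fin] at h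
    omega
  have key : ∀ f : Fin (2 * n + 2) → BoxType,
      (Finset.univ.filter fun i => f i = T).card
        = (Finset.univ.filter fun i : Fin n => f ⟨i, by omega⟩ = T).card
          + (Finset.univ.filter fun j : Fin (n + 2) => f ⟨n + j, by omega⟩ = T).card := by
    intro f
    have e : n + (n + 2) = 2 * n + 2 := by omega
    simp only [Finset.card_filter]
    rw [← (finCongr e).sum_comp, Fin.sum_univ_add]
    rfl
  have cnt : ∀ (m : ℕ) (p : Fin m → Prop) [DecidablePred p] (s : Finset ℕ),
      (∀ j ∈ s, j < m) → (∀ j : Fin m, p j ↔ (j : ℕ) ∈ s) →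
      (Finset.univ.filter p).card = s.card := by
    intro m p _ s hs h
    rw [← Finset.card_map Fin.valEmbedding]
    congr 1
    ext j
    simp only [Finset.mem_map, Finset.mem_filter, Finset.mem_univ, true_and,
      Fin.valEmbedding_apply]
    exact ⟨by rintro ⟨i, hi, rfl⟩; exact (h i).1 hi, fun hj => ⟨⟨j, hs j hj⟩, (h _).2 hj, rfl⟩⟩
  have hbox : ∀ j : Fin (n + 2), boxType n ⟨n + j, by omega⟩ =
      if (j : ℕ) < n then .coin else if (j : ℕ) = n then .freeReward else .one := fun j => by
    have h1 : n + (j : ℕ) < 2 * n ↔ (j : ℕ) < n := by omega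
    have h2 : n + (j : ℕ) = 2 * n ↔ (j : ℕ) = n := by omega
    simp [boxType, h1, h2]
  have harr : ∀ j : Fin (n + 2), arrivalType x ⟨n + j, by omega⟩ =
      if (j : ℕ) < n - weight x then .coin else if (j : ℕ) = n - weight x then .freeReward
        else if (j : ℕ) = n - weight x + 1 then .one else .zero := fun j => by
    have h1 : n + (j : ℕ) < 2 * n - weight x ↔ (j : ℕ) < n - weight x := by omega
    have h2 : n + (j : ℕ) = 2 * n - weight x ↔ (j : ℕ) = n - weight x := by omega
    have h3 : n + (j : ℕ) = 2 * n - weight x + 1 ↔ (j : ℕ) = n - weight x + 1 := by omega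
    simp [arrivalType, h1, h2, h3]
  have hbox' : ∀ i : Fin n, boxType n ⟨i, by omega⟩ = .zero := fun i => by simp [boxType]
  have harr' : ∀ i : Fin n, arrivalType x ⟨i, by omega⟩ = if x i = true then .coin else .zero :=
    fun i => by simp [arrivalType]
  rw [key, key]
  simp only [hbox, harr, hbox', harr']
  cases T
  · rw [cnt (n + 2) _ (Finset.Ico (n - weight x + 2) (n + 2)) (by simp)
        (fun j => by have := j.2; split_ifs <;> simp <;> omega),
      cnt (n + 2) _ ∅ (by simp) (fun j => by split_ifs <;> simp)]
    simp [hx']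
  · rw [cnt (n + 2) _ (Finset.range (n - weight x)) (fun j => by simp; omega)
        (fun j => by split_ifs <;> simp <;> omega),
      cnt (n + 2) _ (Finset.range n) (fun j => by simp; omega)
        (fun j => by split_ifs <;> simp <;> omega)]
    simp [hx]
    omega
  · rw [cnt (n + 2) _ {n - weight x} (fun j => by simp; omega)
        (fun j => by split_ifs <;> simp <;> omega),
      cnt (n + 2) _ {n} (fun j => by simp; omega)
        (fun j => by split_ifs <;> simp <;> omega)]
    simp [ite_eq_iff]
  · rw [cnt (n + 2) _ {n - weight x + 1} (fun j => by simp; omega)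
        (fun j => by split_ifs <;> simp <;> omega),
      cnt (n + 2) _ {n + 1} (fun j => by simp; omega)
        (fun j => by have := j.2; split_ifs <;> simp <;> omega)]
    simp [ite_eq_iff]

theorem exists_isHardOrder (x : Fin n → Bool) : ∃ π, IsHardOrder x π := by
  classical
  have h : ∀ T, Nonempty ({i // arrivalType x i = T} ≃ {i // boxType n i = T}) := fun T =>
    ⟨Fintype.equivOfCardEq (by
      rw [Fintype.card_subtype, Fintype.card_subtype]; exact card_fiber_arrivalType x T)⟩
  exact ⟨Equiv.ofFiberEquiv fun T => (h T).some, fun i =>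
    Equiv.ofFiberEquiv_map (fun T => (h T).some) i⟩

theorem arrivalLaw_hardDists {x : Fin n → Bool} {π : Equiv.Perm (Fin (2 * n + 2))}
    (hπ : IsHardOrder x π) (ε : ℝ≥0) (hε : ε ≤ 1) :
    arrivalLaw (hardDists n ε hε) π
      = Measure.pi fun i => ((arrivalType x i).law ε hε : Measure ℝ≥0) := by
  simp only [arrivalLaw, hardDists, hπ _]

theorem lintegral_freeReward {ε : ℝ≥0} (h0 : 0 < ε) (hε : ε ≤ 1) :
    ∫⁻ y, (y : ℝ≥0∞) ∂(BoxType.freeReward.law ε hε : Measure ℝ≥0) = 1 := by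
  rw [BoxType.law, lintegral_twoPoint, ← ENNReal.coe_mul, mul_one_div_cancel h0.ne']
  simp

/-- The rule that gambles on the value at time `T` and otherwise takes the one at time `T'`. -/
def gambleRule {m : ℕ} (T T' : Fin m) : StoppingRule m where
  accept t := {h | t = T ∧ h ⟨t, le_refl t⟩ ≠ 0 ∨ t = T'}
  measurableSet_accept t := by
    by_cases h : t = T' <;> by_cases h' : t = T
    · simp [h]
    · simp [h]
    · subst h'
      have hm : Measurable fun h : Set.Iic t → ℝ≥0 => h ⟨t, le_refl t⟩ := measurable_pi_apply _
      simp only [h, or_false, true_and]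
      exact (measurableSet_singleton (0 : ℝ≥0)).compl.preimage hm
    · simp [h, h']

theorem gambleRule_reward_ge {m : ℕ} {T T' : Fin m} (hT : T < T') (v : Fin m → ℝ≥0) :
    (v T : ℝ≥0∞) + {v : Fin m → ℝ≥0 | v T = 0}.indicator 1 v * v T'
      ≤ ((gambleRule T T').reward v : ℝ≥0∞) := by
  have hw : ∀ t, (gambleRule T T').Wants v t ↔ (t = T ∧ v t ≠ 0 ∨ t = T') := fun t => Iff.rfl
  by_cases h : v T = 0
  · have : (gambleRule T T').StopsAt v T' := by
      refine ⟨(hw _).2 (.inr rfl), fun s hs => ?_⟩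
      rw [hw]
      rintro (⟨rfl, h'⟩ | rfl)
      · exact h' h
      · exact lt_irrefl _ hs
    rw [StoppingRule.reward_of_stopsAt this, h]
    simp [h]
  · have : (gambleRule T T').StopsAt v T := by
      refine ⟨(hw _).2 (.inl ⟨rfl, h⟩), fun s hs => ?_⟩
      rw [hw]
      rintro (⟨rfl, -⟩ | rfl)
      · exact lt_irrefl _ hs
      · exact lt_asymm hs hT
    rw [StoppingRule.reward_of_stopsAt this]
    simp [h]

/-- Knowing when the free reward comes, one gambles on it for an expected 1; with probability `1 -
ε` it is 0 and the deterministic 1 is still to come. -/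
theorem two_sub_le_opt_hardDists {ε : ℝ≥0} (h0 : 0 < ε) (hε : ε ≤ 1) (x : Fin n → Bool)
    (π : Equiv.Perm (Fin (2 * n + 2))) (hπ : IsHardOrder x π) :
    (2 - ε : ℝ≥0∞) ≤ opt (hardDists n ε hε) π := by
  refine le_trans ?_ (le_iSup _ (gambleRule (freeTime x) (oneTime x)))
  rw [expectedReward, arrivalLaw_hardDists hπ]
  set μ := Measure.pi fun i => ((arrivalType x i).law ε hε : Measure ℝ≥0)
  have hm : MeasurableSet {v : Fin (2 * n + 2) → ℝ≥0 | v (freeTime x) = 0} :=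
    measurableSet_eq_fun (measurable_pi_apply _) measurable_const
  calc (2 - ε : ℝ≥0∞) ≤ 1 + (1 - ε : ℝ≥0) * 1 := by
        rw [mul_one, ENNReal.coe_sub, ENNReal.coe_one, tsub_le_iff_right, add_assoc,
          tsub_add_cancel_of_le (by exact_mod_cast hε), one_add_one_eq_two]
    _ ≤ ∫⁻ v, ((v (freeTime x) : ℝ≥0∞)
          + {v : Fin (2 * n + 2) → ℝ≥0 | v (freeTime x) = 0}.indicator 1 v * v (oneTime x)) ∂μ := by
        have hfree : Measurable fun v : Fin (2 * n + 2) → ℝ≥0 => (v (freeTime x) : ℝ≥0∞) :=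
          (measurable_pi_apply (freeTime x)).coe_nnreal_ennreal
        rw [lintegral_add_left hfree]
        gcongr
        · rw [(measurePreserving_eval _ (freeTime x)).lintegral_comp measurable_coe_nnreal_ennreal,
            arrivalType_freeTime, lintegral_freeReward h0 hε]
        · rw [lintegral_pi_mul_eval _ (oneTime x) (measurable_one.indicator hm)
            measurable_coe_nnreal_ennreal, arrivalType_oneTime]
          · gcongr
            · have h2 : ∀ v : Fin (2 * n + 2) → ℝ≥0,
                  {v : Fin (2 * n + 2) → ℝ≥0 | v (freeTime x) = 0}.indicator (1 : (Fin (2 * n + 2) → ℝ≥0) → ℝ≥0∞) v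
                    = ({0} : Set ℝ≥0).indicator 1 (v (freeTime x)) := fun v => rfl
              simp only [h2]
              rw [(measurePreserving_eval _ (freeTime x)).lintegral_comp
                  (measurable_one.indicator (measurableSet_singleton 0)),
                arrivalType_freeTime, BoxType.law, lintegral_twoPoint]
              simp
            · rw [BoxType.law, lintegral_twoPoint]; simp
          · intro v y
            have : Function.update v (oneTime x) y (freeTime x) = v (freeTime x) :=
              Function.update_of_ne (freeTime_lt_oneTime x).ne _ _
            simp [Set.indicator, this]
    _ ≤ _ := lintegral_mono fun v => gambleRule_reward_ge (freeTime_lt_oneTime x) v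

end Orders

/-! ### Binomial estimates and counting vectors of forced weight -/

section CentralBinomial

/-- Gives the `k^(-1/2)` decay of `centralBinom k / 4^k`. The induction rests on `(2k+1)(2k+3) ≤
4(k+1)^2`. -/
theorem two_mul_add_one_mul_centralBinom_sq_le (k : ℕ) :
    (2 * k + 1) * k.centralBinom ^ 2 ≤ 16 ^ k := by
  induction k with
  | zero => simp
  | succ k ih =>
    have h := Nat.succ_mul_centralBinom_succ k
    refine Nat.le_of_mul_le_mul_left (c := (k + 1) ^ 2) ?_ (by positivity)
    calc (k + 1) ^ 2 * ((2 * (k + 1) + 1) * (k + 1).centralBinom ^ 2)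
        = (2 * k + 3) * ((k + 1) * (k + 1).centralBinom) ^ 2 := by ring
      _ = 4 * ((2 * k + 3) * (2 * k + 1)) * ((2 * k + 1) * k.centralBinom ^ 2) := by
          rw [h]; ring
      _ ≤ 4 * (4 * (k + 1) ^ 2) * 16 ^ k := by
          exact Nat.mul_le_mul (by nlinarith) ih
      _ = (k + 1) ^ 2 * 16 ^ (k + 1) := by ring

/-- By Pascal's rule each atom of a fair binomial law averages two atoms with one trial fewer, so
the largest atom does not grow with the number of trials. -/
theorem choose_mul_four_pow_le (k d j : ℕ) :
    (2 * k + d).choose j * 4 ^ k ≤ k.centralBinom * 2 ^ (2 * k + d) := by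
  induction d generalizing j with
  | zero =>
    rw [add_zero, pow_mul]
    exact Nat.mul_le_mul_right _ (Nat.choose_le_centralBinom j k)
  | succ d ih =>
    cases j with
    | zero =>
      have h0 := ih 0
      rw [Nat.choose_zero_right] at h0 ⊢
      refine h0.trans ?_
      gcongr <;> omega
    | succ j =>
      rw [← add_assoc, Nat.choose_succ_succ, add_mul, pow_succ]
      have := ih j
      have := ih (j + 1)
      linarith

/-- Here `C` is the set of visible bits. Within `S` a pattern on `C` forces the total weight, hence
the number of ones off `C`, so it extends in at most `choose m (m/2)` ways. -/
theorem card_mul_four_pow_le {n k : ℕ} (C : Finset (Fin n)) (hC : 2 * k ≤ Cᶜ.card)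
    (S : Finset (Fin n → Bool))
    (hS : ∀ x ∈ S, ∀ y ∈ S, (∀ i ∈ C, x i = y i) → weight x = weight y) :
    S.card * 4 ^ k ≤ 2 ^ n * k.centralBinom := by
  classical
  set m := Cᶜ.card with hm
  have hfib : ∀ w ∈ C.powerset,
      (S.filter fun x => C.filter (fun i => x i = true) = w).card ≤ m.choose (m / 2) := by
    intro w _
    by_cases h : ∃ x ∈ S, C.filter (fun i => x i = true) = w
    swap
    · rw [Finset.filter_false_of_mem fun x hx hxw => h ⟨x, hx, hxw⟩]
      simp
    · obtain ⟨x₀, hx₀⟩ := h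
      refine le_trans ?_ (Nat.choose_le_middle (weight x₀ - w.card) m)
      rw [hm, ← Finset.card_powersetCard]
      have hagree : ∀ {x y : Fin n → Bool}, C.filter (fun i => x i = true) = w →
          C.filter (fun i => y i = true) = w → ∀ i ∈ C, x i = y i := by
        intro x y hx hy i hi
        have : (i ∈ C.filter fun i => x i = true) ↔ i ∈ C.filter fun i => y i = true := by
          rw [hx, hy]
        simp only [Finset.mem_filter, hi, true_and] at this
        exact Bool.eq_iff_iff.2 this
      -- With the pattern `w` on `C` fixed, `x` is determined by its ones off `C`, a set of size
      -- `weight x₀ - w.card`.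
      refine Finset.card_le_card_of_injOn (fun x => Cᶜ.filter fun i => x i = true) ?_ ?_
      · intro x hx
        have hx' := Finset.mem_filter.1 (Finset.mem_coe.1 hx)
        have hwt : weight x = weight x₀ :=
          hS x hx'.1 x₀ hx₀.1 (hagree hx'.2 hx₀.2)
        have hsplit : (C.filter fun i => x i = true).card
            + (Cᶜ.filter fun i => x i = true).card = weight x := by
          rw [weight, ← Finset.card_union_of_disjoint, ← Finset.filter_union,
            Finset.union_compl]
          exact Finset.disjoint_filter_filter disjoint_compl_right
        rw [Finset.mem_coe, Finset.mem_powersetCard]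
        refine ⟨Finset.filter_subset _ _, ?_⟩
        rw [hx'.2] at hsplit
        beta_reduce
        omega
      · intro x hx y hy hxy
        have hx' := Finset.mem_filter.1 (Finset.mem_coe.1 hx)
        have hy' := Finset.mem_filter.1 (Finset.mem_coe.1 hy)
        funext i
        by_cases hi : i ∈ C
        · exact hagree hx'.2 hy'.2 i hi
        · have : (i ∈ Cᶜ.filter fun i => x i = true) ↔ i ∈ Cᶜ.filter fun i => y i = true := by
            rw [show (Cᶜ.filter fun i => x i = true) = Cᶜ.filter fun i => y i = true from hxy]
          simp only [Finset.mem_filter, Finset.mem_compl, hi, not_false_eq_true, true_and] at this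
          exact Bool.eq_iff_iff.2 this
  have hcard : S.card ≤ m.choose (m / 2) * 2 ^ C.card := by
    rw [← Finset.card_powerset]
    exact Finset.card_le_mul_card_image_of_maps_to
      (fun x _ => Finset.mem_powerset.2 (Finset.filter_subset _ _)) _ hfib
  have hn : C.card + m = n := by rw [hm, Finset.card_add_card_compl, Fintype.card_fin]
  obtain ⟨d, hd⟩ := Nat.exists_eq_add_of_le hC
  calc S.card * 4 ^ k ≤ m.choose (m / 2) * 2 ^ C.card * 4 ^ k := Nat.mul_le_mul_right _ hcard
    _ = 2 ^ C.card * (m.choose (m / 2) * 4 ^ k) := by ring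
    _ ≤ 2 ^ C.card * (k.centralBinom * 2 ^ m) := by
        rw [hd]
        exact Nat.mul_le_mul_left _ (choose_mul_four_pow_le k d _)
    _ = 2 ^ (C.card + m) * k.centralBinom := by rw [pow_add]; ring
    _ = 2 ^ n * k.centralBinom := congrArg (fun a => 2 ^ a * k.centralBinom) hn

end CentralBinomial

/-! ### One coin sequence shared by all bit vectors -/

section Coins

variable {n : ℕ}

/-- The law of a fair coin with values in `{0, 1}`. -/
noncomputable def coinLaw : ProbabilityMeasure ℝ≥0 :=
  twoPoint 2⁻¹ (inv_le_one_of_one_le₀ one_le_two) 1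

/-- Independent fair coins. -/
noncomputable def coinsLaw (m : ℕ) : Measure (Fin m → ℝ≥0) :=
  Measure.pi fun _ => (coinLaw : Measure ℝ≥0)

instance (m : ℕ) : IsProbabilityMeasure (coinsLaw m) := by
  unfold coinsLaw; infer_instance

/-- The coin values, with those at the first `n` times deleted where the bit of `x` is `0`. -/
def mask (x : Fin n → Bool) (c : Fin (2 * n + 2) → ℝ≥0) (i : Fin (2 * n + 2)) : ℝ≥0 :=
  if h : (i : ℕ) < n then (if x ⟨i, h⟩ = true then c i else 0) else c i

theorem measurable_mask (x : Fin n → Bool) : Measurable (mask x) := by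
  refine measurable_pi_lambda _ fun i => ?_
  unfold mask
  by_cases h : (i : ℕ) < n
  · cases hx : x ⟨i, h⟩ <;> simp [h, hx, measurable_pi_apply]
  · simp [h, measurable_pi_apply]

/-- A bit is invisible wherever the coin lands 0: this is the source of the rule's ignorance. -/
theorem mask_congr {x y : Fin n → Bool} {c : Fin (2 * n + 2) → ℝ≥0}
    (h : ∀ i : Fin n, c ⟨i, by omega⟩ ≠ 0 → x i = y i) : mask x c = mask y c := by
  funext i
  unfold mask
  split_ifs with h1 h2 h3 h3
  · rfl
  · by_contra hc
    exact h3 (h ⟨i, h1⟩ hc ▸ h2)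
  · by_contra hc
    exact h2 ((h ⟨i, h1⟩ (Ne.symm hc)).symm ▸ h3)
  · rfl
  · rfl

/-- Two to the minus number of zeros among the first `n` coins. -/
noncomputable def zerosWeight (c : Fin (2 * n + 2) → ℝ≥0) : ℝ≥0∞ :=
  ∏ i : Fin (2 * n + 2), if (i : ℕ) < n ∧ c i = 0 then 2⁻¹ else 1

theorem zerosWeight_eq (c : Fin (2 * n + 2) → ℝ≥0) :
    zerosWeight c
      = 2⁻¹ ^ (Finset.univ.filter fun i : Fin n => c ⟨i, by omega⟩ = 0).card := by
  have e : n + (n + 2) = 2 * n + 2 := by omega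
  rw [zerosWeight, ← (finCongr e).prod_comp, Fin.prod_univ_add]
  simp [Finset.prod_ite]
  rfl

/-- Each of the first `n` coins contributes the factor `1/2 + 1/2 * 1/2 = 3/4`. -/
theorem lintegral_zerosWeight :
    ∫⁻ c, zerosWeight (n := n) c ∂(coinsLaw (2 * n + 2)) = (3 / 4) ^ n := by
  have h : ∀ i : Fin (2 * n + 2),
      ∫⁻ y, (if (i : ℕ) < n ∧ y = 0 then 2⁻¹ else 1) ∂(coinLaw : Measure ℝ≥0)
        = if (i : ℕ) < n then (3 / 4 : ℝ≥0∞) else 1 := by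
    intro i
    rw [coinLaw, lintegral_twoPoint]
    by_cases hi : (i : ℕ) < n
    · simp only [hi, one_ne_zero, and_false, and_self, if_true, if_false]
      have h1 : (1 - 2⁻¹ : ℝ≥0) = 2⁻¹ := by
        rw [tsub_eq_iff_eq_add_of_le (inv_le_one_of_one_le₀ one_le_two)]
        norm_num
      have h2 : (3 / 4 : ℝ≥0∞) = ((3 / 4 : ℝ≥0) : ℝ≥0∞) := by
        rw [ENNReal.coe_div (by norm_num)]; rfl
      have h3 : (2⁻¹ : ℝ≥0∞) = ((2⁻¹ : ℝ≥0) : ℝ≥0∞) := by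
        rw [ENNReal.coe_inv (by norm_num)]; rfl
      rw [h1, h2, h3, ← ENNReal.coe_one, ← ENNReal.coe_mul, ← ENNReal.coe_mul, ← ENNReal.coe_add]
      norm_num
    · simp only [hi, false_and, if_false, mul_one]
      rw [← ENNReal.coe_add, add_tsub_cancel_of_le (inv_le_one_of_one_le₀ one_le_two),
        ENNReal.coe_one]
  have e : n + (n + 2) = 2 * n + 2 := by omega
  simp only [zerosWeight, coinsLaw]
  rw [lintegral_pi_prod _ (fun (i : Fin (2 * n + 2)) y => if (i : ℕ) < n ∧ y = 0 then 2⁻¹ else 1)]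
  · simp only [h]
    rw [← (finCongr e).prod_comp, Fin.prod_univ_add]
    simp
  · exact fun i => Measurable.ite ((MeasurableSet.const _).inter (measurableSet_singleton 0))
      measurable_const measurable_const

/-- Vectors agreeing on the visible bits give the same masked sequence, hence one stopping time and
one weight. The first term is the resulting count when at least `2k` bits are invisible; the second
is a Markov-type bound for the remaining coin sequences. -/
theorem sum_stopsAt_oneTime_le (R : StoppingRule (2 * n + 2)) (k : ℕ)
    (c : Fin (2 * n + 2) → ℝ≥0) :
    ∑ x : Fin n → Bool, {c | R.StopsAt (mask x c) (oneTime x)}.indicator (1 : (Fin (2 * n + 2) → ℝ≥0) → ℝ≥0∞) c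
      ≤ 2 ^ n * (k.centralBinom / 4 ^ k + 4 ^ k * zerosWeight c) := by
  classical
  set C : Finset (Fin n) := Finset.univ.filter fun i : Fin n => c ⟨i, by omega⟩ ≠ 0 with hC
  set S : Finset (Fin n → Bool) :=
    Finset.univ.filter fun x => R.StopsAt (mask x c) (oneTime x) with hS
  have hCc : Cᶜ = Finset.univ.filter fun i : Fin n => c ⟨i, by omega⟩ = 0 := by
    ext i; simp [hC]
  have hsum : ∑ x : Fin n → Bool,
      {c | R.StopsAt (mask x c) (oneTime x)}.indicator (1 : (Fin (2 * n + 2) → ℝ≥0) → ℝ≥0∞) c = (S.card : ℝ≥0∞) := by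
    simp [hS, Set.indicator_apply, Finset.sum_boole]
  rw [hsum, zerosWeight_eq, ← hCc]
  by_cases hk : 2 * k ≤ Cᶜ.card
  · have h := card_mul_four_pow_le C hk S (by
      intro x hx y hy hxy
      have hx' := (Finset.mem_filter.1 hx).2
      have hy' := (Finset.mem_filter.1 hy).2
      have hm : mask x c = mask y c := mask_congr fun i hi => hxy i (by simp [hC, hi])
      rw [hm] at hx'
      exact weight_eq_of_oneTime_eq (hx'.eq hy'))
    have h' : (S.card : ℝ≥0∞) * 4 ^ k ≤ 2 ^ n * k.centralBinom := by exact_mod_cast h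
    calc (S.card : ℝ≥0∞) ≤ 2 ^ n * k.centralBinom / 4 ^ k := by
          rw [ENNReal.le_div_iff_mul_le (.inl (by positivity))
            (.inl (ENNReal.pow_ne_top ENNReal.ofNat_ne_top))]
          exact h'
      _ = 2 ^ n * (k.centralBinom / 4 ^ k) := mul_div_assoc _ _ _
      _ ≤ _ := by gcongr; exact le_self_add
  · have h1 : S.card ≤ 2 ^ n := (Finset.card_le_univ S).trans_eq (by simp)
    -- With fewer than `2k` zeros the second term alone exceeds the trivial bound `2^n`.
    have h2 : (1 : ℝ≥0∞) ≤ 4 ^ k * 2⁻¹ ^ Cᶜ.card := by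
      calc (1 : ℝ≥0∞) = 4 ^ k * 2⁻¹ ^ (2 * k) := by
            rw [pow_mul, ← mul_pow, show (4 : ℝ≥0∞) = 2 ^ 2 by norm_num, ← mul_pow,
              ENNReal.mul_inv_cancel two_ne_zero ENNReal.ofNat_ne_top, one_pow, one_pow]
        _ ≤ _ := by
            gcongr 4 ^ k * ?_
            exact pow_le_pow_right_of_le_one' (by simp) (by omega)
    calc (S.card : ℝ≥0∞) ≤ 2 ^ n * 1 := by rw [mul_one]; exact_mod_cast h1
      _ ≤ _ := by gcongr; exact h2.trans le_add_self

theorem sum_coinsLaw_stopsAt_oneTime_le (R : StoppingRule (2 * n + 2)) (k : ℕ) :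
    ∑ x : Fin n → Bool, coinsLaw (2 * n + 2) {c | R.StopsAt (mask x c) (oneTime x)}
      ≤ 2 ^ n * (k.centralBinom / 4 ^ k + 4 ^ k * (3 / 4) ^ n) := by
  have hm : ∀ x : Fin n → Bool, MeasurableSet {c | R.StopsAt (mask x c) (oneTime x)} := fun x =>
    measurable_mask x (R.measurableSet_stopsAt _)
  have hz : Measurable (zerosWeight (n := n)) := by
    unfold zerosWeight
    refine Finset.measurable_fun_prod _ fun i _ => ?_
    refine Measurable.ite ?_ measurable_const measurable_const
    exact (MeasurableSet.const _).inter (measurableSet_eq_fun (measurable_pi_apply i)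
      measurable_const)
  calc ∑ x : Fin n → Bool, coinsLaw (2 * n + 2) {c | R.StopsAt (mask x c) (oneTime x)}
      = ∫⁻ c, ∑ x : Fin n → Bool,
          {c | R.StopsAt (mask x c) (oneTime x)}.indicator (1 : (Fin (2 * n + 2) → ℝ≥0) → ℝ≥0∞) c
          ∂(coinsLaw (2 * n + 2)) := by
        rw [lintegral_finsetSum _ fun x _ => measurable_one.indicator (hm x)]
        exact Finset.sum_congr rfl fun x _ => (lintegral_indicator_one (hm x)).symm
    _ ≤ ∫⁻ c, 2 ^ n * (k.centralBinom / 4 ^ k + 4 ^ k * zerosWeight c) ∂(coinsLaw (2 * n + 2)) :=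
        lintegral_mono fun c => sum_stopsAt_oneTime_le R k c
    _ = _ := by
        rw [lintegral_const_mul _ (by fun_prop), lintegral_add_left measurable_const,
          lintegral_const_mul _ hz, lintegral_zerosWeight]
        simp

end Coins

/-! ### Reduction of a blind rule's reward to the coin model -/

section UpperBound

variable {n : ℕ}

theorem twoPoint_apply (p : ℝ≥0) (hp : p ≤ 1) (x : ℝ≥0) {s : Set ℝ≥0} (hs : MeasurableSet s) :
    (twoPoint p hp x : Measure ℝ≥0) s
      = p * s.indicator 1 x + (1 - p : ℝ≥0) * s.indicator 1 0 := by
  rw [← lintegral_indicator_one hs, lintegral_twoPoint]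

theorem ae_twoPoint (p : ℝ≥0) (hp : p ≤ 1) (x : ℝ≥0) :
    ∀ᵐ y ∂(twoPoint p hp x : Measure ℝ≥0), y = 0 ∨ y = x := by
  have hs : MeasurableSet {y : ℝ≥0 | y = 0 ∨ y = x}ᶜ :=
    ((measurableSet_singleton 0).union (measurableSet_singleton x)).compl
  rw [ae_iff]
  change (twoPoint p hp x : Measure ℝ≥0) {y : ℝ≥0 | y = 0 ∨ y = x}ᶜ = 0
  rw [twoPoint_apply p hp x hs]
  simp

theorem ae_twoPoint_one (x : ℝ≥0) : ∀ᵐ y ∂(twoPoint 1 le_rfl x : Measure ℝ≥0), y = x := by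
  have hs : MeasurableSet {y : ℝ≥0 | y = x}ᶜ := (measurableSet_singleton x).compl
  rw [ae_iff]
  change (twoPoint 1 le_rfl x : Measure ℝ≥0) {y : ℝ≥0 | y = x}ᶜ = 0
  rw [twoPoint_apply 1 le_rfl x hs]
  simp

/-- The values that a box can take with positive probability. -/
def BoxType.Possible (ε : ℝ≥0) : BoxType → ℝ≥0 → Prop
  | .zero, y => y = 0
  | .coin, y => y = 0 ∨ y = 1
  | .freeReward, y => y = 0 ∨ y = 1 / ε
  | .one, y => y = 1

theorem BoxType.ae_possible (T : BoxType) (ε : ℝ≥0) (hε : ε ≤ 1) :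
    ∀ᵐ y ∂(T.law ε hε : Measure ℝ≥0), T.Possible ε y := by
  cases T
  · exact ae_twoPoint_one 0
  · exact ae_twoPoint 2⁻¹ (inv_le_one_of_one_le₀ one_le_two) 1
  · exact ae_twoPoint ε hε (1 / ε)
  · exact ae_twoPoint_one 1

theorem ae_pi_possible (τ : Fin n → BoxType) (ε : ℝ≥0) (hε : ε ≤ 1) :
    ∀ᵐ v ∂(Measure.pi fun i => ((τ i).law ε hε : Measure ℝ≥0)), ∀ i, (τ i).Possible ε (v i) := by
  rw [ae_all_iff]
  intro i
  exact (measurePreserving_eval (fun i => ((τ i).law ε hε : Measure ℝ≥0)) i).quasiMeasurePreserving.ae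
    ((τ i).ae_possible ε hε)

/-- Accepting before the free reward yields at most 1. Otherwise the free reward pays for
everything, even for the later 1 when it is nonzero, since `1/ε ≥ 1`; only the 1 taken after a zero
free reward is left over. -/
theorem reward_le_of_possible (R : StoppingRule (2 * n + 2)) {x : Fin n → Bool} {ε : ℝ≥0}
    (h0 : 0 < ε) (hε : ε ≤ 1) {v : Fin (2 * n + 2) → ℝ≥0}
    (hv : ∀ i, (arrivalType x i).Possible ε (v i)) :
    (R.reward v : ℝ≥0∞) ≤
      {v | ∃ s < freeTime x, R.Wants v s}.indicator 1 v
        + {v | ∃ s < freeTime x, R.Wants v s}ᶜ.indicator 1 v * v (freeTime x)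
        + {v | R.StopsAt v (oneTime x) ∧ v (freeTime x) = 0}.indicator 1 v := by
  by_cases hs : ∃ t, R.StopsAt v t
  swap
  · push Not at hs
    rw [StoppingRule.reward_of_not_stopsAt hs]
    exact zero_le
  obtain ⟨t, ht⟩ := hs
  rw [StoppingRule.reward_of_stopsAt ht]
  by_cases hE : ∃ s < freeTime x, R.Wants v s
  · have hmem : v ∈ {v | ∃ s < freeTime x, R.Wants v s} := hE
    rw [Set.indicator_of_mem hmem, Pi.one_apply, add_assoc]
    refine le_trans ?_ le_self_add
    obtain ⟨s, hs, hw⟩ := hE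
    obtain ⟨r, hr, hr'⟩ := StoppingRule.exists_stopsAt_of_wants hw
    obtain rfl := ht.eq hr'
    have hlt := hr.trans_lt hs
    have h := hv t
    have : v t ≤ 1 := by
      by_cases hn : (t : ℕ) < n
      · rw [arrivalType_of_lt x hn] at h
        split_ifs at h
        · rcases h with h | h <;> simp [h]
        · simp [show v t = 0 from h]
      · rw [arrivalType_of_ge_of_lt x (not_lt.1 hn) hlt] at h
        rcases h with h | h <;> simp [h]
    exact_mod_cast this
  · have hmem : v ∈ {v | ∃ s < freeTime x, R.Wants v s}ᶜ := hE
    rw [Set.indicator_of_mem hmem, Pi.one_apply, one_mul]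
    rcases lt_trichotomy t (oneTime x) with h | h | h
    · have hle : t ≤ freeTime x := by
        rw [Fin.lt_def] at h
        rw [Fin.le_def]
        simp only [oneTime, freeTime] at h ⊢
        omega
      rcases hle.lt_or_eq with h' | rfl
      · exact absurd ⟨t, h', ht.1⟩ hE
      · exact le_add_self.trans le_self_add
    · subst h
      have h1 := hv (oneTime x)
      rw [arrivalType_oneTime] at h1
      have h2 := hv (freeTime x)
      rw [arrivalType_freeTime] at h2
      rw [show v (oneTime x) = 1 from h1]
      rcases h2 with h2 | h2
      · have : v ∈ {v | R.StopsAt v (oneTime x) ∧ v (freeTime x) = 0} := ⟨ht, h2⟩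
        rw [Set.indicator_of_mem this]
        exact le_add_self
      · refine le_trans ?_ (le_add_self.trans le_self_add)
        rw [h2]
        exact ENNReal.coe_le_coe.2 ((one_le_div h0).2 hε)
    · have h1 := hv t
      rw [arrivalType_of_oneTime_lt x h] at h1
      simp [show v t = 0 from h1]

/-- Whether the rule wants to accept before the free reward is independent of the free reward, whose
mean is 1. The first two terms thus contribute `μ E + μ Eᶜ = 1`. -/
theorem expectedReward_le (R : StoppingRule (2 * n + 2)) {ε : ℝ≥0} (h0 : 0 < ε) (hε : ε ≤ 1)
    (x : Fin n → Bool) :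
    ∫⁻ v, R.reward v ∂(Measure.pi fun i => ((arrivalType x i).law ε hε : Measure ℝ≥0))
      ≤ 1 + (Measure.pi fun i => ((arrivalType x i).law ε hε : Measure ℝ≥0))
          {v | R.StopsAt v (oneTime x) ∧ v (freeTime x) = 0} := by
  set μ := Measure.pi fun i => ((arrivalType x i).law ε hε : Measure ℝ≥0) with hμ
  set E := {v | ∃ s < freeTime x, R.Wants v s} with hE
  have hEm : MeasurableSet E := by
    have : E = ⋃ s, ⋃ _ : s < freeTime x, {v | R.Wants v s} := by ext v; simp [hE]
    rw [this]
    exact MeasurableSet.iUnion fun s => MeasurableSet.iUnion fun _ => R.measurableSet_wants s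
  have hBm : MeasurableSet {v | R.StopsAt v (oneTime x) ∧ v (freeTime x) = 0} :=
    (R.measurableSet_stopsAt _).inter
      (measurableSet_eq_fun (measurable_pi_apply _) measurable_const)
  have hvm : Measurable fun v : Fin (2 * n + 2) → ℝ≥0 => (v (freeTime x) : ℝ≥0∞) :=
    (measurable_pi_apply (freeTime x)).coe_nnreal_ennreal
  have hEv : Measurable fun v : Fin (2 * n + 2) → ℝ≥0 =>
      Eᶜ.indicator (1 : (Fin (2 * n + 2) → ℝ≥0) → ℝ≥0∞) v * v (freeTime x) :=
    (measurable_one.indicator hEm.compl).mul hvm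
  have hEi : Measurable fun v : Fin (2 * n + 2) → ℝ≥0 =>
      E.indicator (1 : (Fin (2 * n + 2) → ℝ≥0) → ℝ≥0∞) v := measurable_one.indicator hEm
  refine (lintegral_mono_ae ((ae_pi_possible _ ε hε).mono fun v hv =>
    reward_le_of_possible R h0 hε hv)).trans_eq ?_
  have hsum : Measurable fun v : Fin (2 * n + 2) → ℝ≥0 =>
      E.indicator (1 : (Fin (2 * n + 2) → ℝ≥0) → ℝ≥0∞) v
        + Eᶜ.indicator (1 : (Fin (2 * n + 2) → ℝ≥0) → ℝ≥0∞) v * v (freeTime x) := hEi.add hEv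
  rw [← hE, lintegral_add_left hsum, lintegral_add_left hEi, lintegral_indicator_one hEm,
    lintegral_indicator_one hBm, lintegral_pi_mul_eval _ (freeTime x)
      (measurable_one.indicator hEm.compl) measurable_coe_nnreal_ennreal, arrivalType_freeTime,
    lintegral_freeReward h0 hε, mul_one, lintegral_indicator_one hEm.compl,
    measure_add_measure_compl hEm, measure_univ]
  intro v y
  have : Function.update v (freeTime x) y ∈ E ↔ v ∈ E := by
    refine exists_congr fun s => and_congr_right fun hs => StoppingRule.wants_congr fun r hr => ?_
    exact Function.update_of_ne (hr.trans_lt hs).ne _ _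
  by_cases hv : v ∈ E
  · rw [Set.indicator_of_notMem (Set.notMem_compl_iff.2 hv),
      Set.indicator_of_notMem (Set.notMem_compl_iff.2 (this.2 hv))]
  · rw [Set.indicator_of_mem (show v ∈ Eᶜ from hv),
      Set.indicator_of_mem (show _ ∈ Eᶜ from mt this.1 hv)]
    rfl

/-- The restricted measure is an atom of mass at most 1 at a point to which the coin gives mass
`1/2`. -/
theorem restrict_le_two_smul_coinLaw {p : ℝ≥0} (hp : p ≤ 1) {x y : ℝ≥0}
    (hy : y = 0 ∧ x ≠ 0 ∨ y = 1 ∧ x = 1) :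
    (twoPoint p hp x : Measure ℝ≥0).restrict {y} ≤ (2 : ℝ≥0) • (coinLaw : Measure ℝ≥0) := by
  refine Measure.le_iff.2 fun s hs => ?_
  have h2 : ((2 : ℝ≥0) : ℝ≥0∞) * ((2⁻¹ : ℝ≥0) : ℝ≥0∞) = 1 := by
    rw [← ENNReal.coe_mul, mul_inv_cancel₀ two_ne_zero, ENNReal.coe_one]
  have h3 : (1 - 2⁻¹ : ℝ≥0) = 2⁻¹ := by
    rw [tsub_eq_iff_eq_add_of_le (inv_le_one_of_one_le₀ one_le_two)]
    norm_num
  rw [Measure.restrict_apply hs, twoPoint_apply p hp x (hs.inter (measurableSet_singleton y)),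
    Measure.smul_apply, coinLaw, twoPoint_apply _ _ _ hs, ENNReal.smul_def, smul_eq_mul, mul_add,
    h3, ← mul_assoc, ← mul_assoc, h2, one_mul, one_mul]
  have hp1 : (p : ℝ≥0∞) ≤ 1 := by exact_mod_cast hp
  have hp2 : ((1 - p : ℝ≥0) : ℝ≥0∞) ≤ 1 := by exact_mod_cast tsub_le_self
  rcases hy with ⟨rfl, hx⟩ | ⟨rfl, rfl⟩
  · by_cases h : (0 : ℝ≥0) ∈ s
    · have : (1 : ℝ≥0∞) ≤ s.indicator 1 1 + 1 := le_add_self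
      simpa [Set.indicator_apply, hx, h] using le_trans hp2 this
    · simp [h]
  · by_cases h : (1 : ℝ≥0) ∈ s
    · have : (1 : ℝ≥0∞) ≤ 1 + s.indicator 1 0 := le_self_add
      simpa [Set.indicator_apply, h] using le_trans hp1 this
    · simp [h]

/-- On this event the free reward and the deterministic 1 show 0 and 1. Replacing each by a fair
coin costs a factor 2, and the remaining arrivals up to `oneTime x` already are masked coins. -/
theorem measure_stopsAt_oneTime_le (R : StoppingRule (2 * n + 2)) {ε : ℝ≥0} (h0 : 0 < ε)
    (hε : ε ≤ 1) (x : Fin n → Bool) :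
    (Measure.pi fun i => ((arrivalType x i).law ε hε : Measure ℝ≥0))
        {v | R.StopsAt v (oneTime x) ∧ v (freeTime x) = 0}
      ≤ 4 * coinsLaw (2 * n + 2) {c | R.StopsAt (mask x c) (oneTime x)} := by
  set B := {v | R.StopsAt v (oneTime x)} with hB
  have hBm : MeasurableSet B := R.measurableSet_stopsAt _
  have hne := (freeTime_lt_oneTime x).ne
  -- `s` pins the two special values, `a` is the price per coordinate (product 4), and `g` turns a
  -- coin into the arriving value, with zeros after `oneTime x` to match the trailing zero boxes.
  let s : Fin (2 * n + 2) → Set ℝ≥0 := fun i =>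
    if i = freeTime x then {0} else if i = oneTime x then {1} else Set.univ
  let a : Fin (2 * n + 2) → ℝ≥0 := fun i => if i = freeTime x ∨ i = oneTime x then 2 else 1
  let g : Fin (2 * n + 2) → ℝ≥0 → ℝ≥0 := fun i y =>
    if oneTime x < i then 0 else if h : (i : ℕ) < n then (if x ⟨i, h⟩ = true then y else 0) else y
  have hg : ∀ i, Measurable (g i) := fun i => by
    simp only [g]
    split_ifs <;> fun_prop
  have ha : ∏ i, a i = 4 := by
    rw [Finset.prod_ite]
    have : (Finset.univ.filter fun i => i = freeTime x ∨ i = oneTime x)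
        = {freeTime x, oneTime x} := by ext i; simp
    rw [this, Finset.prod_const, Finset.prod_const_one, Finset.card_pair hne]
    norm_num
  have hdom : ∀ i, ((arrivalType x i).law ε hε : Measure ℝ≥0).restrict (s i)
      ≤ a i • (coinLaw : Measure ℝ≥0).map (g i) := by
    intro i
    rcases lt_trichotomy i (oneTime x) with h | h | h
    · by_cases hf : i = freeTime x
      · have hg' : g i = id := by
          have : ¬ 2 * n - weight x < n := by have := weight_le x; omega
          funext y
          rw [hf] at h ⊢
          simp only [g, h.not_gt, if_false]
          simp [freeTime, this]
        have hs' : s i = {0} := if_pos hf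
        have ha' : a i = 2 := if_pos (.inl hf)
        rw [hg', hs', ha', Measure.map_id, hf, arrivalType_freeTime]
        exact restrict_le_two_smul_coinLaw hε (.inl ⟨rfl, (one_div_pos.2 h0).ne'⟩)
      · have hs' : s i = Set.univ := by simp [s, hf, h.ne]
        have ha' : a i = 1 := by simp [a, hf, h.ne]
        rw [hs', ha', Measure.restrict_univ, one_smul]
        by_cases hn : (i : ℕ) < n
        · rw [arrivalType_of_lt x hn]
          by_cases hx : x ⟨i, hn⟩ = true
          · have hg' : g i = id := by funext y; simp [g, h.not_gt, hn, hx]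
            rw [hg', Measure.map_id, if_pos hx]
            exact le_rfl
          · have hg' : g i = fun _ => 0 := by funext y; simp [g, hn, hx]
            rw [hg', Measure.map_const, if_neg hx, measure_univ, one_smul]
            refine Measure.le_iff.2 fun t ht => ?_
            rw [BoxType.law, twoPoint_apply _ _ _ ht, Measure.dirac_apply' _ ht]
            simp
        · have hlt : i < freeTime x := by
            refine lt_of_le_of_ne ?_ hf
            rw [Fin.lt_def] at h
            rw [Fin.le_def]
            simp only [oneTime, freeTime] at h ⊢
            omega
          have hg' : g i = id := by funext y; simp [g, h.not_gt, hn]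
          rw [arrivalType_of_ge_of_lt x (not_lt.1 hn) hlt, hg', Measure.map_id]
          exact le_rfl
    · have hg' : g i = id := by
        have : ¬ 2 * n - weight x + 1 < n := by have := weight_le x; omega
        funext y
        simp [g, h, oneTime, this]
      have hs' : s i = {1} := by simp [s, h, hne.symm]
      have ha' : a i = 2 := if_pos (.inr h)
      rw [hg', hs', ha', Measure.map_id, h, arrivalType_oneTime]
      exact restrict_le_two_smul_coinLaw le_rfl (.inr ⟨rfl, rfl⟩)
    · have hg' : g i = fun _ => 0 := by funext y; simp [g, h]
      have hf : i ≠ freeTime x := ((freeTime_lt_oneTime x).trans h).ne'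
      have hs' : s i = Set.univ := by simp [s, hf, h.ne']
      have ha' : a i = 1 := by simp [a, hf, h.ne']
      rw [hs', ha', Measure.restrict_univ, one_smul, arrivalType_of_oneTime_lt x h, hg',
        Measure.map_const, measure_univ, one_smul]
      refine Measure.le_iff.2 fun t ht => ?_
      rw [BoxType.law, twoPoint_apply _ _ _ ht, Measure.dirac_apply' _ ht]
      simp
  have : ∀ i, IsProbabilityMeasure ((coinLaw : Measure ℝ≥0).map (g i)) := fun i =>
    Measure.isProbabilityMeasure_map (hg i).aemeasurable
  have hgm : Measurable fun (c : Fin (2 * n + 2) → ℝ≥0) i => g i (c i) :=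
    measurable_pi_lambda _ fun i => (hg i).comp (measurable_pi_apply i)
  calc (Measure.pi fun i => ((arrivalType x i).law ε hε : Measure ℝ≥0))
        {v | R.StopsAt v (oneTime x) ∧ v (freeTime x) = 0}
      ≤ (Measure.pi fun i => ((arrivalType x i).law ε hε : Measure ℝ≥0))
          (B ∩ Set.univ.pi s) := by
        refine measure_mono_ae ((ae_pi_possible _ ε hε).mono fun v hv hvB => ⟨hvB.1, ?_⟩)
        intro i _
        simp only [s]
        split_ifs with h1 h2
        · rw [h1]; exact hvB.2
        · have := hv i
          rw [h2, arrivalType_oneTime] at this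
          rw [h2]; exact this
        · trivial
    _ = (Measure.pi fun i => ((arrivalType x i).law ε hε : Measure ℝ≥0).restrict (s i)) B := by
        rw [← Measure.restrict_apply hBm, Measure.restrict_pi_pi]
    _ ≤ ((∏ i, a i) • Measure.pi fun i => (coinLaw : Measure ℝ≥0).map (g i)) B :=
        pi_le_prod_smul_pi _ _ a hdom B
    _ = 4 * coinsLaw (2 * n + 2) ((fun c i => g i (c i)) ⁻¹' B) := by
        rw [ha, ← Measure.pi_map_pi fun i => (hg i).aemeasurable, Measure.smul_apply,
          Measure.map_apply hgm hBm]
        rfl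
    _ ≤ _ := by
        gcongr
        intro c hc
        -- `g` and `mask x` differ only after `oneTime x`, too late to affect stopping there.
        refine (StoppingRule.stopsAt_congr fun i hi => ?_).1 hc
        simp only [g, mask, hi.not_gt, if_false]

end UpperBound

/-! ### Asymptotics, randomization and the gap -/

section Gap

theorem sum_value_hardDists_le (A : BlindAlgorithm) {n : ℕ} {ε : ℝ≥0} (h0 : 0 < ε) (hε : ε ≤ 1)
    (k : ℕ) (π : (Fin n → Bool) → Equiv.Perm (Fin (2 * n + 2))) (hπ : ∀ x, IsHardOrder x (π x)) :
    (∑ x, A.value (hardDists n ε hε) (π x)) / 2 ^ n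
      ≤ 1 + (4 * (k.centralBinom / 4 ^ k) + 4 * 4 ^ k * (3 / 4) ^ n) := by
  set R := A (2 * n + 2) (hardDists n ε hε)
  have hval : ∀ x, A.value (hardDists n ε hε) (π x)
      ≤ 1 + 4 * coinsLaw (2 * n + 2) {c | R.StopsAt (mask x c) (oneTime x)} := fun x => by
    rw [BlindAlgorithm.value, expectedReward, arrivalLaw_hardDists (hπ x)]
    exact (expectedReward_le R h0 hε x).trans
      (add_le_add_right (measure_stopsAt_oneTime_le R h0 hε x) 1)
  refine ENNReal.div_le_of_le_mul ?_
  calc ∑ x, A.value (hardDists n ε hε) (π x)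
      ≤ ∑ x : Fin n → Bool,
          (1 + 4 * coinsLaw (2 * n + 2) {c | R.StopsAt (mask x c) (oneTime x)}) :=
        Finset.sum_le_sum fun x _ => hval x
    _ = 2 ^ n + 4 * ∑ x : Fin n → Bool,
          coinsLaw (2 * n + 2) {c | R.StopsAt (mask x c) (oneTime x)} := by
        rw [Finset.sum_add_distrib, Finset.mul_sum]
        simp
    _ ≤ 2 ^ n + 4 * (2 ^ n * (k.centralBinom / 4 ^ k + 4 ^ k * (3 / 4) ^ n)) := by
        gcongr
        exact sum_coinsLaw_stopsAt_oneTime_le R k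
    _ = _ := by ring

theorem exists_centralBinom_le {r : ℝ≥0} (hr : 0 < r) :
    ∃ k : ℕ, (k.centralBinom : ℝ≥0) ≤ r * 4 ^ k := by
  obtain ⟨k, hk⟩ := exists_nat_ge ((r ^ 2)⁻¹)
  refine ⟨k, ?_⟩
  have h : ((2 * k + 1 : ℝ≥0)) * (k.centralBinom : ℝ≥0) ^ 2 ≤ 16 ^ k := by
    exact_mod_cast two_mul_add_one_mul_centralBinom_sq_le k
  have hrk : 1 ≤ r ^ 2 * (2 * k + 1 : ℝ≥0) := by
    calc (1 : ℝ≥0) = r ^ 2 * (r ^ 2)⁻¹ := (mul_inv_cancel₀ (by positivity)).symm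
      _ ≤ r ^ 2 * (2 * k + 1) := by
        gcongr
        refine hk.trans ?_
        calc (k : ℝ≥0) ≤ k + (k + 1) := le_self_add
          _ = 2 * k + 1 := by ring
  refine (pow_le_pow_iff_left₀ zero_le zero_le two_ne_zero).1 ?_
  calc (k.centralBinom : ℝ≥0) ^ 2 = 1 * (k.centralBinom : ℝ≥0) ^ 2 := (one_mul _).symm
    _ ≤ r ^ 2 * (2 * k + 1) * (k.centralBinom : ℝ≥0) ^ 2 := by gcongr
    _ = r ^ 2 * ((2 * k + 1) * (k.centralBinom : ℝ≥0) ^ 2) := mul_assoc _ _ _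
    _ ≤ r ^ 2 * 16 ^ k := by gcongr
    _ = (r * 4 ^ k) ^ 2 := by rw [mul_pow, ← pow_mul, mul_comm k, pow_mul]; norm_num

/-- The order of choice matters: `k` first makes the binomial term small, then large `n` beats the
now constant factor `4^k`. -/
theorem exists_error_le {δ : ℝ≥0} (hδ : 0 < δ) : ∃ k N : ℕ, ∀ n ≥ N,
    (4 * (k.centralBinom / 4 ^ k) + 4 * 4 ^ k * (3 / 4) ^ n : ℝ≥0∞) ≤ δ := by
  obtain ⟨k, hk⟩ := exists_centralBinom_le (r := δ / 8) (by positivity)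
  have h1 : (4 * (k.centralBinom / 4 ^ k) : ℝ≥0∞) ≤ (δ / 2 : ℝ≥0) := by
    have : (k.centralBinom / 4 ^ k : ℝ≥0∞) ≤ (δ / 8 : ℝ≥0) := by
      refine ENNReal.div_le_of_le_mul ?_
      exact_mod_cast hk
    calc (4 * (k.centralBinom / 4 ^ k) : ℝ≥0∞) ≤ 4 * (δ / 8 : ℝ≥0) := by gcongr
      _ = ((4 * (δ / 8) : ℝ≥0) : ℝ≥0∞) := by rw [ENNReal.coe_mul]; rfl
      _ = _ := by congr 1; ring
  have hlt : (3 / 4 : ℝ≥0∞) < 1 := by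
    rw [ENNReal.div_lt_iff (.inl (by norm_num)) (.inl (by norm_num))]
    norm_num
  have hlim : Filter.Tendsto (fun n : ℕ => (4 * 4 ^ k * (3 / 4) ^ n : ℝ≥0∞)) Filter.atTop
      (nhds 0) := by
    have := ENNReal.Tendsto.const_mul (a := (4 * 4 ^ k : ℝ≥0∞))
      (ENNReal.tendsto_pow_atTop_nhds_zero_of_lt_one hlt)
      (.inr (ENNReal.mul_ne_top (by norm_num) (ENNReal.pow_ne_top (by norm_num))))
    rwa [mul_zero] at this
  have hpos : (0 : ℝ≥0∞) < (δ / 2 : ℝ≥0) := by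
    rw [ENNReal.coe_pos]; positivity
  obtain ⟨N, hN⟩ := Filter.eventually_atTop.1 (hlim.eventually (ge_mem_nhds hpos))
  refine ⟨k, N, fun n hn => (add_le_add h1 (hN n hn)).trans_eq ?_⟩
  rw [← ENNReal.coe_add, add_halves]

theorem exists_forall_average_value_le {ε : ℝ≥0} (h0 : 0 < ε) (hε : ε ≤ 1) {δ : ℝ≥0}
    (hδ : 0 < δ) : ∃ N : ℕ, ∀ n ≥ N,
      ∀ π : (Fin n → Bool) → Equiv.Perm (Fin (2 * n + 2)), (∀ x, IsHardOrder x (π x)) →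
        ∀ A : BlindAlgorithm,
          (∑ x, A.value (hardDists n ε hε) (π x)) / 2 ^ n ≤ (1 + δ : ℝ≥0∞) := by
  obtain ⟨k, N, hN⟩ := exists_error_le hδ
  exact ⟨N, fun n hn π hπ A => (sum_value_hardDists_le A h0 hε k π hπ).trans
    (add_le_add_right (hN n hn) 1)⟩

/-- Superadditivity of the lower integral needs no measurability, so measurability of the value in
the seed never has to be checked. -/
theorem sum_lintegral_le_lintegral_sum {α ι : Type*} [MeasurableSpace α] (μ : Measure α)
    (s : Finset ι) (f : ι → α → ℝ≥0∞) :
    ∑ i ∈ s, ∫⁻ a, f i a ∂μ ≤ ∫⁻ a, ∑ i ∈ s, f i a ∂μ := by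
  classical
  induction s using Finset.induction_on with
  | empty => simp
  | insert i s hi ih =>
    simp only [Finset.sum_insert hi]
    exact (add_le_add_right ih _).trans (le_lintegral_add _ _)

/-- The easy direction of Yao's principle: a bound on the average over orders, valid for every
deterministic algorithm, survives mixing over seeds. -/
theorem RandomizedBlindAlgorithm.average_value_le {Ω : Type u} [MeasurableSpace Ω] (P : Measure Ω)
    [IsProbabilityMeasure P] (A : RandomizedBlindAlgorithm Ω) {m : ℕ} (F : Dists m) {ι : Type*}
    [Fintype ι] (π : ι → Equiv.Perm (Fin m)) {b c : ℝ≥0∞}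
    (h : ∀ B : BlindAlgorithm, (∑ x, B.value F (π x)) / c ≤ b) (hc : c ≠ 0) (hc' : c ≠ ∞) :
    (∑ x, A.value P F (π x)) / c ≤ b := by
  refine ENNReal.div_le_of_le_mul ?_
  calc ∑ x, A.value P F (π x) ≤ ∫⁻ ω, ∑ x, (A.alg ω).value F (π x) ∂P :=
        sum_lintegral_le_lintegral_sum P _ _
    _ ≤ ∫⁻ _, b * c ∂P := lintegral_mono fun ω =>
        (ENNReal.div_le_iff_le_mul (.inl hc) (.inl hc')).1 (h (A.alg ω))
    _ = b * c := by simp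

theorem lintegral_hardDists_ne_top (n : ℕ) (ε : ℝ≥0) (hε : ε ≤ 1) (i : Fin (2 * n + 2)) :
    ∫⁻ x, (x : ℝ≥0∞) ∂(hardDists n ε hε i : Measure ℝ≥0) ≠ ∞ := by
  rw [hardDists]
  cases boxType n i <;> rw [BoxType.law, lintegral_twoPoint] <;> finiteness

/-- A performance whose average over the hard orders is asymptotically at most `1` does not have
worst-case ratio bounded away from `1 / 2` from above. -/
theorem not_half_add_le_worstRatio {perf : ∀ n : ℕ, Dists n → Equiv.Perm (Fin n) → ℝ≥0∞}
    (h : ∀ (ε : ℝ≥0) (_ : 0 < ε) (hε : ε ≤ 1) (δ : ℝ≥0), 0 < δ →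
      ∃ (n : ℕ) (π : (Fin n → Bool) → Equiv.Perm (Fin (2 * n + 2))), (∀ x, IsHardOrder x (π x)) ∧
        (∑ x, perf _ (hardDists n ε hε) (π x)) / 2 ^ n ≤ (1 + δ : ℝ≥0∞))
    {ε : ℝ≥0} (h0 : 0 < ε) : ¬ (1 / 2 + ε : ℝ≥0∞) ≤ worstRatio perf := by
  intro hle
  set η : ℝ≥0 := min 1 ε with hη
  have hη0 : 0 < η := lt_min one_pos h0
  have hη1 : η ≤ 1 := min_le_left _ _
  have hηε : η ≤ ε := min_le_right _ _
  -- From `η ≤ ε` and `η ≤ 1` one gets `(1/2 + ε)(2 - η) ≥ 1 + ε/2`, which exceeds `1 + ε/4`.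
  obtain ⟨n, π, hπ, hav⟩ := h η hη0 hη1 (ε / 4) (by positivity)
  have hsub : (2 - η : ℝ≥0∞) = ((2 - η : ℝ≥0) : ℝ≥0∞) := by rw [ENNReal.coe_sub]; rfl
  have hsubpos : 0 < 2 - η := tsub_pos_of_lt (hη1.trans_lt one_lt_two)
  have hperf : ∀ x, (1 / 2 + ε : ℝ≥0∞) * (2 - η) ≤ perf _ (hardDists n η hη1) (π x) := fun x => by
    have hopt := two_sub_le_opt_hardDists hη0 hη1 x (π x) (hπ x)
    have hne : opt (hardDists n η hη1) (π x) ≠ 0 := by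
      refine (lt_of_lt_of_le ?_ hopt).ne'
      rw [hsub]; exact_mod_cast hsubpos
    have hratio : (1 / 2 + ε : ℝ≥0∞)
        ≤ perf _ (hardDists n η hη1) (π x) / opt (hardDists n η hη1) (π x) :=
      hle.trans (iInf_le_of_le _ (iInf_le_of_le (hardDists n η hη1) (iInf_le_of_le
        (lintegral_hardDists_ne_top n η hη1) (iInf_le_of_le (π x) (iInf_le _ hne)))))
    calc (1 / 2 + ε : ℝ≥0∞) * (2 - η) ≤ (1 / 2 + ε) * opt (hardDists n η hη1) (π x) := by gcongr
      _ ≤ _ := ENNReal.mul_le_of_le_div hratio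
  have hlow : (1 / 2 + ε : ℝ≥0∞) * (2 - η) ≤ 1 + (ε / 4 : ℝ≥0) := by
    refine le_trans ?_ hav
    rw [ENNReal.le_div_iff_mul_le (.inl (by positivity))
      (.inl (ENNReal.pow_ne_top ENNReal.ofNat_ne_top))]
    calc (1 / 2 + ε : ℝ≥0∞) * (2 - η) * 2 ^ n
        = ∑ _x : Fin n → Bool, (1 / 2 + ε : ℝ≥0∞) * (2 - η) := by
          rw [Finset.sum_const, nsmul_eq_mul, mul_comm]; simp
      _ ≤ _ := Finset.sum_le_sum fun x _ => hperf x
  have hlow' : (1 / 2 + ε) * (2 - η) ≤ 1 + ε / 4 := by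
    rw [hsub] at hlow
    have h2 : (1 / 2 : ℝ≥0∞) = ((1 / 2 : ℝ≥0) : ℝ≥0∞) := by
      rw [ENNReal.coe_div two_ne_zero]; rfl
    rw [h2] at hlow
    exact_mod_cast hlow
  rw [← NNReal.coe_le_coe] at hlow'
  push_cast [NNReal.coe_sub (hη1.trans one_le_two)] at hlow'
  have a0 : (0 : ℝ) < ε := h0
  have a1 : (η : ℝ) ≤ 1 := hη1
  have a2 : (η : ℝ) ≤ ε := hηε
  nlinarith [mul_le_mul_of_nonneg_left a1 a0.le]

theorem not_exists_half_add_le_gap {ε : ℝ≥0} (hε : 0 < ε) :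
    (¬ ∃ A : BlindAlgorithm, (1 / 2 + ε : ℝ≥0∞) ≤ A.gap) ∧
      (∀ (Ω : Type u) [MeasurableSpace Ω] (P : Measure Ω) [IsProbabilityMeasure P],
        ¬ ∃ A : RandomizedBlindAlgorithm Ω, (1 / 2 + ε : ℝ≥0∞) ≤ A.gap P) := by
  constructor
  · rintro ⟨A, hA⟩
    refine not_half_add_le_worstRatio (fun η h0 h1 δ hδ => ?_) hε hA
    obtain ⟨N, hN⟩ := exists_forall_average_value_le h0 h1 hδ
    choose π hπ using fun x : Fin N → Bool => exists_isHardOrder x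
    exact ⟨N, π, hπ, hN N le_rfl π hπ A⟩
  · rintro Ω _ P _ ⟨A, hA⟩
    refine not_half_add_le_worstRatio (fun η h0 h1 δ hδ => ?_) hε hA
    obtain ⟨N, hN⟩ := exists_forall_average_value_le h0 h1 hδ
    choose π hπ using fun x : Fin N → Bool => exists_isHardOrder x
    exact ⟨N, π, hπ, A.average_value_le P _ π (hN N le_rfl π hπ) (by positivity)
      (ENNReal.pow_ne_top ENNReal.ofNat_ne_top)⟩

end Gap

end ProphetBlind

theorem theorem1 :
    -- No deterministic or randomized identity-blind algorithm has gap at least `1/2 + ε`.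
    (∀ ε : ℝ≥0, 0 < ε →
      (¬ ∃ A : ProphetBlind.BlindAlgorithm, (1 / 2 + ε : ℝ≥0∞) ≤ A.gap) ∧
      (∀ (Ω : Type u) [MeasurableSpace Ω] (P : Measure Ω) [IsProbabilityMeasure P],
        ¬ ∃ A : ProphetBlind.RandomizedBlindAlgorithm Ω, (1 / 2 + ε : ℝ≥0∞) ≤ A.gap P)) ∧
    -- The hard instance: the driven orders exist, ...
    (∀ (n : ℕ) (x : Fin n → Bool), ∃ π, ProphetBlind.IsHardOrder x π) ∧
    (∀ (ε : ℝ≥0) (_ : 0 < ε) (hε : ε ≤ 1),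
      -- ... under each of them the order-aware optimum is at least `2 - ε`, ...
      (∀ (n : ℕ) (x : Fin n → Bool) (π : Equiv.Perm (Fin (2 * n + 2))),
        ProphetBlind.IsHardOrder x π →
          (2 - ε : ℝ≥0∞) ≤ ProphetBlind.opt (ProphetBlind.hardDists n ε hε) π) ∧
      -- ... and every identity-blind algorithm gets on average at most `1 + o(1)` as `n → ∞`.
      (∀ δ : ℝ≥0, 0 < δ → ∃ N : ℕ, ∀ n ≥ N,
        ∀ π : (Fin n → Bool) → Equiv.Perm (Fin (2 * n + 2)),
          (∀ x, ProphetBlind.IsHardOrder x (π x)) →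
          (∀ A : ProphetBlind.BlindAlgorithm,
            (∑ x, A.value (ProphetBlind.hardDists n ε hε) (π x)) / 2 ^ n ≤ (1 + δ : ℝ≥0∞)) ∧
          (∀ (Ω : Type u) [MeasurableSpace Ω] (P : Measure Ω) [IsProbabilityMeasure P]
            (A : ProphetBlind.RandomizedBlindAlgorithm Ω),
            (∑ x, A.value P (ProphetBlind.hardDists n ε hε) (π x)) / 2 ^ n
              ≤ (1 + δ : ℝ≥0∞)))) ∧
    -- Tightness: some single-threshold algorithm has gap exactly `1/2`.
    (∃ τ : ∀ n : ℕ, ProphetBlind.Dists n → ℝ≥0,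
      (ProphetBlind.BlindAlgorithm.singleThreshold τ).gap = 1 / 2) := by
  refine ⟨fun ε hε => ProphetBlind.not_exists_half_add_le_gap hε,
    fun n x => ProphetBlind.exists_isHardOrder x, fun ε h0 hε =>
    ⟨fun n x π hπ => ProphetBlind.two_sub_le_opt_hardDists h0 hε x π hπ, fun δ hδ => ?_⟩,
    ProphetBlind.halfMax, le_antisymm ?_ ProphetBlind.half_le_gap_singleThreshold_halfMax⟩
  · obtain ⟨N, hN⟩ := ProphetBlind.exists_forall_average_value_le h0 hε hδ
    exact ⟨N, fun n hn π hπ => ⟨hN n hn π hπ, fun Ω _ P _ A =>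
      A.average_value_le P _ π (hN n hn π hπ) (by positivity)
        (ENNReal.pow_ne_top ENNReal.ofNat_ne_top)⟩⟩
  -- The threshold algorithm is itself blind and deterministic, so impossibility for every `ε` caps
  -- its gap at `1/2`.
  · refine ENNReal.le_of_forall_pos_le_add fun ε hε _ => le_of_lt (not_le.1 fun h => ?_)
    exact (ProphetBlind.not_exists_half_add_le_gap.{0} hε).1 ⟨_, h⟩
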